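/- Let $\Omega$ be a compact metric space, $T:\Omega\to\Omega$ a homeomorphism and $f:\Omega\to\mathbb D=\{|z|<1\}$ continuous (no minimality is assumed). For $\alpha\in\mathbb D$ put $\rho_\alpha=(1-|\alpha|^2)^{1/2}$ and, for $z\in\partial\mathbb D$, $$S(\alpha,z)=\frac1{\rho_\alpha}\begin{pmatrix}z&-\bar\alpha\\-\alpha z&1\end{pmatrix},\quad P(\alpha,z)=\frac1{\rho_\alpha}\begin{pmatrix}-\alpha&z^{-1}\\z&-\bar\alpha\end{pmatrix},\quad Q(\alpha,z)=\frac1{\rho_\alpha}\begin{pmatrix}-\bar\alpha&1\\1&-\alpha\end{pmatrix}.$$ The Szegő cocycle is $(T,A_z)$ with $A_z(\omega)=S(f(\omega),z)$, and the Gesztesy–Zinchenko cocycle is $(T^2,G_z)$ with $G_z(\omega)=Q(f(T\omega),z)P(f(\omega),z)$. For a homeomorphism $T$ and a continuous map $A$ from $\Omega$ to the matrices in $\mathrm{GL}(2,\mathbb C)$ with $|\det|=1$, let $A^n(\omega)$, $n\in\mathbb Z$, be the iterates, so that $(T,A)^n=(T^n,A^n)$. The cocycle $(T,A)$ is called uniformly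 hyperbolic if one of the following (equivalent) conditions holds: (a) there are $C>0$, $\lambda>1$ with $\|A^n(\omega)\|\ge C\lambda^{|n|}$ for all $n\in\mathbb Z$, $\omega\in\Omega$; (b) there are $c>0$, $L>1$ and continuous maps $\Lambda^s,\Lambda^u:\Omega\to\mathbb{CP}^1$ with $A(\omega)\Lambda^{s}(\omega)=\Lambda^{s}(T\omega)$, $A(\omega)\Lambda^{u}(\omega)=\Lambda^{u}(T\omega)$ and $\|A^n(\omega)v_s\|\le cL^{-n}\|v_s\|$, $\|A^{-n}(\omega)v_u\|\le cL^{-n}\|v_u\|$ for all $n\ge1$, $\omega\in\Omega$, $v_s\in\Lambda^s(\omega)$, $v_u\in\Lambda^u(\omega)$; (c) there are no $\omega\in\Omega$ and unit vector $v\in\mathbb C^2$ with $\|A^n(\omega)v\|\le1$ for all $n\in\mathbb Z$. For $\omega\in\Omega$ let $\alpha_n=f(T^n\omega)$, $\rho_n=\rho_{\alpha_n}$, and let $\mathcal E_\omega$ be the extended CMV matrix, the bounded operator on $\ell^2(\mathbb Z)$ given by $$(\mathcal E_\omega u)_n=\overline{\alpha_n}\rho_{n-1}u_{n-1}-\overline{\alpha_n}\alpha_{n-1}u_n+\overline{\alpha_{n+1}}\rho_nu_{n+1}+\rho_{n+1}\rho_nu_{n+2}\quad(n\text{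 even}),$$ $$(\mathcal E_\omega u)_n=\rho_{n-1}\rho_{n-2}u_{n-2}-\rho_{n-1}\alpha_{n-2}u_{n-1}-\overline{\alpha_n}\alpha_{n-1}u_n-\rho_n\alpha_{n-1}u_{n+1}\quad(n\text{ odd}).$$ Then for every $z\in\partial\mathbb D$ the three cocycles $(T,A_z)$, $(T^2,A_z^2)$ and $(T^2,G_z)$ are either all uniformly hyperbolic or all not uniformly hyperbolic, and if $U$ denotes the set of $z\in\partial\mathbb D$ for which they are uniformly hyperbolic, then $\sigma(\mathcal E_\omega)\subseteq\partial\mathbb D\setminus U$ for every $\omega\in\Omega$. -/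

import Mathlib

open scoped ComplexConjugate Topology Complex.UnitDisc LinearAlgebra.Projectivization

noncomputable section

namespace CMV

/-! ### Cocycles over a homeomorphism -/

/-- The Hermitian space `ℂ²`. -/
abbrev C2 : Type := EuclideanSpace ℂ (Fin 2)

/-- A `2 × 2` complex matrix as a bounded operator on `ℂ²`; its norm is the operator norm. -/
def act (M : Matrix (Fin 2) (Fin 2) ℂ) : C2 →L[ℂ] C2 :=
  Matrix.toEuclideanCLM (n := Fin 2) (𝕜 := ℂ) M

section Cocycle

variable {Ω : Type*} [TopologicalSpace Ω]

/-- `A^n(ω) = A(T^{n-1} ω) ⋯ A(ω)` for natural `n`. -/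
def iterPos (T : Ω ≃ₜ Ω) (A : Ω → Matrix (Fin 2) (Fin 2) ℂ) (ω : Ω) :
    ℕ → Matrix (Fin 2) (Fin 2) ℂ
  | 0 => 1
  | n + 1 => A ((T ^ n) ω) * iterPos T A ω n

/-- `A^{-n}(ω) = A(T^{-n} ω)⁻¹ ⋯ A(T^{-1} ω)⁻¹` for natural `n`. -/
def iterNeg (T : Ω ≃ₜ Ω) (A : Ω → Matrix (Fin 2) (Fin 2) ℂ) (ω : Ω) :
    ℕ → Matrix (Fin 2) (Fin 2) ℂ
  | 0 => 1
  | n + 1 => (A ((T ^ (-((n : ℤ) + 1))) ω))⁻¹ * iterNeg T A ω n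

/-- The iterates `A^n(ω)`, `n ∈ ℤ`, of the cocycle `(T, A)`. They are used for matrices `A(ω)`
whose determinant has absolute value one. -/
def iter (T : Ω ≃ₜ Ω) (A : Ω → Matrix (Fin 2) (Fin 2) ℂ) (n : ℤ) (ω : Ω) :
    Matrix (Fin 2) (Fin 2) ℂ :=
  if 0 ≤ n then iterPos T A ω n.toNat else iterNeg T A ω (-n).toNat

/-- Uniform exponential growth of `(T, A)`. -/
def UniformExpGrowth (T : Ω ≃ₜ Ω) (A : Ω → Matrix (Fin 2) (Fin 2) ℂ) : Prop :=
  ∃ C L : ℝ, 0 < C ∧ 1 < L ∧ ∀ (n : ℤ) (ω : Ω), C * L ^ |n| ≤ ‖act (iter T A n ω)‖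

/-- The angle metric on the complex projective line: `arccos |⟨v, w⟩|` for unit vectors `v ∈ V`,
`w ∈ W` (here the chosen representatives are normalized). -/
def angleDist (V W : ℙ ℂ C2) : ℝ :=
  Real.arccos (‖inner ℂ V.rep W.rep‖ / (‖V.rep‖ * ‖W.rep‖))

/-- Continuity of a map into the projective line with the angle metric. -/
def ContinuousProj (Λ : Ω → ℙ ℂ C2) : Prop :=
  ∀ ω : Ω, Filter.Tendsto (fun ω' => angleDist (Λ ω') (Λ ω)) (𝓝 ω) (𝓝 0)

/-- `(T, A)` admits an invariant exponential splitting. -/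
def InvariantExpSplitting (T : Ω ≃ₜ Ω) (A : Ω → Matrix (Fin 2) (Fin 2) ℂ) : Prop :=
  ∃ (c L : ℝ) (Λs Λu : Ω → ℙ ℂ C2), 0 < c ∧ 1 < L ∧
    ContinuousProj Λs ∧ ContinuousProj Λu ∧
    (∀ ω, (Λs ω).submodule.map (act (A ω)).toLinearMap = (Λs (T ω)).submodule ∧
      (Λu ω).submodule.map (act (A ω)).toLinearMap = (Λu (T ω)).submodule) ∧
    ∀ n : ℕ, 0 < n → ∀ ω : Ω,
      (∀ v ∈ (Λs ω).submodule, ‖act (iter T A n ω) v‖ ≤ c * (L ^ n)⁻¹ * ‖v‖) ∧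
      (∀ v ∈ (Λu ω).submodule, ‖act (iter T A (-n) ω) v‖ ≤ c * (L ^ n)⁻¹ * ‖v‖)

/-- `(T, A)` enjoys a Sacker–Sell solution. -/
def SackerSell (T : Ω ≃ₜ Ω) (A : Ω → Matrix (Fin 2) (Fin 2) ℂ) : Prop :=
  ∃ (ω : Ω) (v : C2), ‖v‖ = 1 ∧ ∀ n : ℤ, ‖act (iter T A n ω) v‖ ≤ 1

/-- `(T, A)` is uniformly hyperbolic: one of the three conditions (uniform exponential
growth, an invariant exponential splitting, no Sacker–Sell solution) holds. -/
def UniformlyHyperbolic (T : Ω ≃ₜ Ω) (A : Ω → Matrix (Fin 2) (Fin 2) ℂ) : Prop :=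
  UniformExpGrowth T A ∨ InvariantExpSplitting T A ∨ ¬ SackerSell T A

end Cocycle

/-! ### Szegő and Gesztesy–Zinchenko matrices -/

/-- `ρ = (1 - |α|²)^{1/2}`. -/
def rho (α : 𝔻) : ℝ := Real.sqrt (1 - ‖(α : ℂ)‖ ^ 2)

/-- The Szegő matrix `S(α, z)`. -/
def szego (α : 𝔻) (z : ℂ) : Matrix (Fin 2) (Fin 2) ℂ :=
  ((rho α : ℂ))⁻¹ • !![z, -conj (α : ℂ); -(α : ℂ) * z, 1]

/-- The Gesztesy–Zinchenko matrix `P(α, z)`. -/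
def gzP (α : 𝔻) (z : ℂ) : Matrix (Fin 2) (Fin 2) ℂ :=
  ((rho α : ℂ))⁻¹ • !![-(α : ℂ), z⁻¹; z, -conj (α : ℂ)]

/-- The Gesztesy–Zinchenko matrix `Q(α, z)`; it does not depend on `z`. -/
def gzQ (α : 𝔻) (_z : ℂ) : Matrix (Fin 2) (Fin 2) ℂ :=
  ((rho α : ℂ))⁻¹ • !![-conj (α : ℂ), 1; 1, -(α : ℂ)]

section Families

variable {Ω : Type*} [TopologicalSpace Ω]

/-- The Szegő cocycle map `A_z(ω) = S(f(ω), z)`. -/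
def szegoMap (f : Ω → 𝔻) (z : ℂ) (ω : Ω) : Matrix (Fin 2) (Fin 2) ℂ := szego (f ω) z

/-- The Gesztesy–Zinchenko cocycle map `G_z(ω) = Q(f(Tω), z) P(f(ω), z)`, over `T²`. -/
def gzMap (T : Ω ≃ₜ Ω) (f : Ω → 𝔻) (z : ℂ) (ω : Ω) : Matrix (Fin 2) (Fin 2) ℂ :=
  gzQ (f (T ω)) z * gzP (f ω) z

/-- The set `U` of `z ∈ ∂𝔻` for which the Szegő cocycle `(T, A_z)` is uniformly hyperbolic. -/
def hyperbolicSet (T : Ω ≃ₜ Ω) (f : Ω → 𝔻) : Set ℂ :=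
  {z | z ∈ Metric.sphere (0 : ℂ) 1 ∧ UniformlyHyperbolic T (szegoMap f z)}

/-- The coefficients `α_ω(n) = f(T^n ω)`. -/
def verblunsky (T : Ω ≃ₜ Ω) (f : Ω → 𝔻) (ω : Ω) (n : ℤ) : 𝔻 := f ((T ^ n) ω)

end Families

/-! ### Extended CMV matrices -/

section Matrix

variable (α : ℤ → 𝔻)

/-- `a_n = -conj α_n α_{n-1}`. -/
def coeffA (n : ℤ) : ℂ := -conj (α n : ℂ) * (α (n - 1) : ℂ)

/-- `b_n = conj α_n ρ_{n-1}`. -/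
def coeffB (n : ℤ) : ℂ := conj (α n : ℂ) * (rho (α (n - 1)) : ℂ)

/-- `c_n = -ρ_n α_{n-1}`. -/
def coeffC (n : ℤ) : ℂ := -(rho (α n) : ℂ) * (α (n - 1) : ℂ)

/-- `d_n = ρ_n ρ_{n-1}`. -/
def coeffD (n : ℤ) : ℂ := (rho (α n) : ℂ) * (rho (α (n - 1)) : ℂ)

/-- The extended CMV matrix applied to a sequence. The nonzero entries of row `n` are
`b_n, a_n, b_{n+1}, d_{n+1}` in columns `n-1, …, n+2` if `n` is even, and
`d_{n-1}, c_{n-1}, a_n, c_n` in columns `n-2, …, n+1` if `n` is odd. -/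
def cmvApply (u : ℤ → ℂ) (n : ℤ) : ℂ :=
  if Even n then
    coeffB α n * u (n - 1) + coeffA α n * u n
      + coeffB α (n + 1) * u (n + 1) + coeffD α (n + 1) * u (n + 2)
  else
    coeffD α (n - 1) * u (n - 2) + coeffC α (n - 1) * u (n - 1)
      + coeffA α n * u n + coeffC α n * u (n + 1)

/-- The Hilbert space `ℓ²(ℤ)`. -/
abbrev l2Z : Type := lp (fun _ : ℤ => ℂ) 2

end Matrix

theorem rho_nonneg (α : 𝔻) : 0 ≤ rho α := Real.sqrt_nonneg _

theorem norm_rho_le (α : 𝔻) : ‖(rho α : ℂ)‖ ≤ 1 := by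
  rw [Complex.norm_real, Real.norm_of_nonneg (rho_nonneg α)]
  exact Real.sqrt_le_one.mpr (by nlinarith [norm_nonneg (α : ℂ)])

theorem norm_coeff_le (α : ℤ → 𝔻) (n : ℤ) :
    ‖coeffA α n‖ ≤ 1 ∧ ‖coeffB α n‖ ≤ 1 ∧ ‖coeffC α n‖ ≤ 1 ∧ ‖coeffD α n‖ ≤ 1 := by
  have h1 := (α n).norm_lt_one.le
  have h2 := (α (n - 1)).norm_lt_one.le
  have h3 := norm_rho_le (α n)
  have h4 := norm_rho_le (α (n - 1))
  simp only [coeffA, coeffB, coeffC, coeffD, norm_mul, norm_neg, RCLike.norm_conj]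
  exact ⟨mul_le_one₀ h1 (norm_nonneg _) h2, mul_le_one₀ h1 (norm_nonneg _) h4,
    mul_le_one₀ h3 (norm_nonneg _) h2, mul_le_one₀ h3 (norm_nonneg _) h4⟩

theorem sq_four_le (x y z w : ℝ) :
    (x + y + z + w) ^ 2 ≤ 4 * (x ^ 2 + y ^ 2 + z ^ 2 + w ^ 2) := by
  nlinarith [sq_nonneg (x - y), sq_nonneg (x - z), sq_nonneg (x - w), sq_nonneg (y - z),
    sq_nonneg (y - w), sq_nonneg (z - w)]

theorem norm_four_le {a b c d x y z w : ℂ} (ha : ‖a‖ ≤ 1) (hb : ‖b‖ ≤ 1) (hc : ‖c‖ ≤ 1)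
    (hd : ‖d‖ ≤ 1) : ‖a * x + b * y + c * z + d * w‖ ^ 2
      ≤ 4 * (‖x‖ ^ 2 + ‖y‖ ^ 2 + ‖z‖ ^ 2 + ‖w‖ ^ 2) := by
  have key : ∀ {p q : ℂ}, ‖p‖ ≤ 1 → ‖p * q‖ ≤ ‖q‖ := fun {p q} hp => by
    rw [norm_mul]; exact mul_le_of_le_one_left (norm_nonneg _) hp
  have h : ‖a * x + b * y + c * z + d * w‖ ≤ ‖x‖ + ‖y‖ + ‖z‖ + ‖w‖ :=
    norm_add₄_le.trans (by gcongr <;> exact key ‹_›)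
  exact (pow_le_pow_left₀ (norm_nonneg _) h 2).trans (sq_four_le _ _ _ _)

theorem norm_cmvApply_sq_le (α : ℤ → 𝔻) (u : ℤ → ℂ) (n : ℤ) :
    ‖cmvApply α u n‖ ^ 2 ≤ 4 * (‖u (n - 2)‖ ^ 2 + ‖u (n - 1)‖ ^ 2 + ‖u n‖ ^ 2
      + ‖u (n + 1)‖ ^ 2 + ‖u (n + 2)‖ ^ 2) := by
  unfold cmvApply
  have h0 := norm_coeff_le α n
  have h1 := norm_coeff_le α (n + 1)
  have h2 := norm_coeff_le α (n - 1)
  split_ifs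
  · refine (norm_four_le h0.2.1 h0.1 h1.2.1 h1.2.2.2).trans ?_
    nlinarith [sq_nonneg ‖u (n - 2)‖]
  · refine (norm_four_le h2.2.2.2 h2.2.2.1 h0.1 h0.2.2.1).trans ?_
    nlinarith [sq_nonneg ‖u (n + 2)‖]

theorem hasSum_sq_shift (u : l2Z) (k : ℤ) :
    HasSum (fun n : ℤ => ‖u (n + k)‖ ^ 2) (‖u‖ ^ 2) := by
  have h := lp.hasSum_norm (p := 2) (by norm_num) u
  simp only [ENNReal.toReal_ofNat, Real.rpow_ofNat] at h
  exact (Equiv.addRight k).hasSum_iff.mpr h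

theorem hasSum_five (u : l2Z) :
    HasSum (fun n : ℤ => 4 * (‖u (n - 2)‖ ^ 2 + ‖u (n - 1)‖ ^ 2 + ‖u n‖ ^ 2
      + ‖u (n + 1)‖ ^ 2 + ‖u (n + 2)‖ ^ 2)) (20 * ‖u‖ ^ 2) := by
  have h := (((((hasSum_sq_shift u (-2)).add (hasSum_sq_shift u (-1))).add
    (hasSum_sq_shift u 0)).add (hasSum_sq_shift u 1)).add (hasSum_sq_shift u 2)).mul_left 4
  simp only [add_zero] at h
  have e : 20 * ‖u‖ ^ 2
      = 4 * (‖u‖ ^ 2 + ‖u‖ ^ 2 + ‖u‖ ^ 2 + ‖u‖ ^ 2 + ‖u‖ ^ 2) := by ring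
  rw [e]
  exact h

theorem memlp_cmvApply (α : ℤ → 𝔻) (u : l2Z) : Memℓp (cmvApply α u) 2 := by
  refine memℓp_gen ?_
  simp only [ENNReal.toReal_ofNat, Real.rpow_ofNat]
  exact Summable.of_nonneg_of_le (fun n => sq_nonneg _) (norm_cmvApply_sq_le α u)
    (hasSum_five u).summable

/-- The extended CMV matrix as a bounded operator on `ℓ²(ℤ)`. -/
def cmv (α : ℤ → 𝔻) : l2Z →L[ℂ] l2Z :=
  LinearMap.mkContinuous
    { toFun := fun u => ⟨cmvApply α u, memlp_cmvApply α u⟩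
      map_add' := fun u v => by
        ext n
        simp only [lp.coeFn_add, Pi.add_apply, cmvApply]
        split_ifs <;> ring
      map_smul' := fun c u => by
        ext n
        simp only [lp.coeFn_smul, Pi.smul_apply, cmvApply, smul_eq_mul, RingHom.id_apply]
        split_ifs <;> ring }
    5 (fun u => by
      refine lp.norm_le_of_tsum_le (p := 2) (by norm_num) (by positivity) ?_
      simp only [ENNReal.toReal_ofNat, Real.rpow_ofNat]
      have h5 := hasSum_five u
      have hs : Summable fun n => ‖cmvApply α u n‖ ^ 2 :=
        Summable.of_nonneg_of_le (fun n => sq_nonneg _) (norm_cmvApply_sq_le α u) h5.summable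
      have := hs.tsum_le_tsum (norm_cmvApply_sq_le α u) h5.summable
      rw [h5.tsum_eq] at this
      refine this.trans ?_
      nlinarith [sq_nonneg ‖u‖])

end CMV

end

noncomputable section

namespace CMV

/-! Everything is measured against one condition: the existence of a nonzero vector whose orbit is
bounded over all of `ℤ`. Each of the three definitions of uniform hyperbolicity excludes such an
orbit, and its absence gives the third definition (`uniformlyHyperbolic_iff`). The first definition
excludes it because the action preserves area up to a unimodular factor: along a bounded orbit there
are arbitrarily long stretches where the iterates grow at most linearly. The second excludes it by
splitting the vector into stable and unstable components.

Bounded orbits survive passage to the second iterate, since intermediate times cost one bounded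
factor, and multiplication by a unimodular scalar. As `Q P = z⁻¹ S S`, the three cocycles have
bounded orbits simultaneously.

For the spectrum, the extended CMV matrix factors as `Θ₀ Θ₁` with block-diagonal unitary factors, so
it is unitary and its spectrum lies on the circle. If `(ℰ - z) u = g`, then `u` and `Θ₁ u` combine
into an approximate orbit of the Szegő cocycle whose errors are controlled by `g`. Without bounded
orbits, compactness makes every vector grow by a large factor within a fixed time window, so a
square-summable approximate orbit is controlled in `ℓ²` by its errors
(`tsum_norm_sq_le_of_not_hasBoundedOrbit`). Hence `ℰ - z` is bounded below and, being normal,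
invertible. -/

abbrev M2 : Type := Matrix (Fin 2) (Fin 2) ℂ

/-! ### Plane geometry in `ℂ²` -/

theorem act_mul (M N : M2) : act (M * N) = act M * act N := map_mul _ M N

theorem act_mul_apply (M N : M2) (v : C2) : act (M * N) v = act M (act N v) := by
  rw [act_mul]; rfl

theorem act_one : act 1 = 1 := map_one _

theorem act_smul (c : ℂ) (M : M2) : act (c • M) = c • act M := map_smul _ c M

theorem act_apply (M : M2) (v : C2) :
    act M v = !₂[M 0 0 * v 0 + M 0 1 * v 1, M 1 0 * v 0 + M 1 1 * v 1] := by
  ext i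
  have h : (act M v) i = (M.mulVec v.ofLp) i := rfl
  rw [h]
  fin_cases i <;> simp [Matrix.mulVec, dotProduct, Fin.sum_univ_two]

theorem continuous_act : Continuous act :=
  (Matrix.toEuclideanCLM
    (n := Fin 2) (𝕜 := ℂ)).toAlgEquiv.toLinearMap.continuous_of_finiteDimensional

/-- The determinant of two vectors in `ℂ²`. -/
def cross (v w : C2) : ℂ := v 0 * w 1 - v 1 * w 0

theorem cross_act (M : M2) (v w : C2) : cross (act M v) (act M w) = M.det * cross v w := by
  simp only [cross, act_apply, Matrix.det_fin_two, PiLp.toLp_apply, Matrix.cons_val_zero,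
    Matrix.cons_val_one]
  ring

theorem norm_sq_C2 (v : C2) : ‖v‖ ^ 2 = ‖v 0‖ ^ 2 + ‖v 1‖ ^ 2 := by
  rw [EuclideanSpace.norm_sq_eq, Fin.sum_univ_two]

/-- Area equals base times height: `c • v` is the orthogonal projection of `w` onto the line of `v`.
-/
theorem exists_smul_near {v : C2} (hv : v ≠ 0) (w : C2) :
    ∃ c : ℂ, ‖v‖ * ‖w - c • v‖ = ‖cross v w‖ := by
  have hv' : 0 < ‖v‖ := norm_pos_iff.mpr hv
  have hne : ((‖v‖ ^ 2 : ℝ) : ℂ) ≠ 0 := by exact_mod_cast (by positivity : ‖v‖ ^ 2 ≠ 0)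
  have hs : ((‖v‖ ^ 2 : ℝ) : ℂ) = conj (v 0) * v 0 + conj (v 1) * v 1 := by
    rw [norm_sq_C2]; push_cast
    rw [Complex.conj_mul', Complex.conj_mul']
  refine ⟨(conj (v 0) * w 0 + conj (v 1) * w 1) / ((‖v‖ ^ 2 : ℝ) : ℂ), ?_⟩
  set c := (conj (v 0) * w 0 + conj (v 1) * w 1) / ((‖v‖ ^ 2 : ℝ) : ℂ) with hc
  have hc' : c * ((‖v‖ ^ 2 : ℝ) : ℂ) = conj (v 0) * w 0 + conj (v 1) * w 1 := by
    rw [hc]; field_simp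
  have e0 : ((‖v‖ ^ 2 : ℝ) : ℂ) * (w 0 - c * v 0) = - conj (v 1) * cross v w := by
    have : ((‖v‖ ^ 2 : ℝ) : ℂ) * (w 0 - c * v 0)
      = ((‖v‖ ^ 2 : ℝ) : ℂ) * w 0 - (c * ((‖v‖ ^ 2 : ℝ) : ℂ)) * v 0 := by ring
    rw [this, hc', hs, cross]; ring
  have e1 : ((‖v‖ ^ 2 : ℝ) : ℂ) * (w 1 - c * v 1) = conj (v 0) * cross v w := by
    have : ((‖v‖ ^ 2 : ℝ) : ℂ) * (w 1 - c * v 1)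
      = ((‖v‖ ^ 2 : ℝ) : ℂ) * w 1 - (c * ((‖v‖ ^ 2 : ℝ) : ℂ)) * v 1 := by ring
    rw [this, hc', hs, cross]; ring
  have n0 := congrArg norm e0
  have n1 := congrArg norm e1
  simp only [norm_mul, Complex.norm_real, norm_neg, RCLike.norm_conj, norm_pow, norm_norm] at n0 n1
  have key : (‖v‖ ^ 2) ^ 2 * ‖w - c • v‖ ^ 2 = ‖v‖ ^ 2 * ‖cross v w‖ ^ 2 := by
    rw [norm_sq_C2 (w - c • v)]
    simp only [PiLp.sub_apply, PiLp.smul_apply, smul_eq_mul]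
    calc _ = (‖v‖ ^ 2 * ‖w 0 - c * v 0‖) ^ 2 + (‖v‖ ^ 2 * ‖w 1 - c * v 1‖) ^ 2 := by ring
      _ = (‖v 0‖ ^ 2 + ‖v 1‖ ^ 2) * ‖cross v w‖ ^ 2 := by rw [n0, n1]; ring
      _ = _ := by rw [norm_sq_C2 v]
  have key2 : (‖v‖ * ‖w - c • v‖) ^ 2 = ‖cross v w‖ ^ 2 := by
    have hp : ‖v‖ ^ 2 ≠ 0 := by positivity
    apply mul_left_cancel₀ hp
    rw [← key]; ring
  exact (sq_eq_sq₀ (by positivity) (norm_nonneg _)).mp key2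

theorem norm_cross_le (v w : C2) : ‖cross v w‖ ≤ ‖v‖ * ‖w‖ := by
  have h : ‖cross v w‖ ≤ ‖v 0‖ * ‖w 1‖ + ‖v 1‖ * ‖w 0‖ := by
    refine (norm_sub_le _ _).trans_eq ?_
    rw [norm_mul, norm_mul]
  refine h.trans (abs_le_of_sq_le_sq' ?_ (by positivity)).2
  rw [mul_pow, norm_sq_C2, norm_sq_C2]
  nlinarith [sq_nonneg (‖v 0‖ * ‖w 0‖ - ‖v 1‖ * ‖w 1‖)]

theorem eq_combination {v w : C2} (h : cross v w ≠ 0) (x : C2) :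
    ∃ a b : ℂ, x = a • v + b • w := by
  refine ⟨cross x w / cross v w, cross v x / cross v w, ?_⟩
  ext i
  simp only [PiLp.add_apply, PiLp.smul_apply, smul_eq_mul]
  field_simp
  fin_cases i <;> simp [cross] <;> ring

/-! ### Algebra and continuity of the iterates -/

section Iterates

variable {Ω : Type*} [TopologicalSpace Ω] {T : Ω ≃ₜ Ω} {A : Ω → M2}

theorem isUnit_det_of_norm {M : M2} (h : ‖M.det‖ = 1) : IsUnit M.det := by
  rw [isUnit_iff_ne_zero]
  intro h0
  simp [h0] at h

theorem iter_zero (ω : Ω) : iter T A 0 ω = 1 := by simp [iter, iterPos]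

theorem iter_add_one (hA : ∀ ω, ‖(A ω).det‖ = 1) (n : ℤ) (ω : Ω) :
    iter T A (n + 1) ω = A ((T ^ n) ω) * iter T A n ω := by
  rcases le_or_gt 0 n with h | h
  · obtain ⟨k, rfl⟩ := Int.eq_ofNat_of_zero_le h
    have h1 : (0 : ℤ) ≤ (k : ℤ) + 1 := by omega
    have h2 : ((k : ℤ) + 1).toNat = k + 1 := by omega
    simp only [iter, if_pos h, if_pos h1, h2, Int.toNat_natCast, iterPos]
    rw [zpow_natCast]
  · obtain ⟨k, rfl⟩ : ∃ k : ℕ, n = -((k : ℤ) + 1) := ⟨(-n - 1).toNat, by omega⟩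
    have e : iter T A (-((k : ℤ) + 1)) ω
        = (A ((T ^ (-((k : ℤ) + 1))) ω))⁻¹ * iterNeg T A ω k := by
      have h2 : (-(-((k : ℤ) + 1))).toNat = k + 1 := by omega
      simp only [iter, if_neg (not_le.mpr h), h2, iterNeg]
    have e' : iter T A (-((k : ℤ) + 1) + 1) ω = iterNeg T A ω k := by
      -- At `k = 0` the exponent moves from `-1` to `0`, where `iter` switches to its nonnegative
      -- branch.
      rcases Nat.eq_zero_or_pos k with rfl | hk
      · simp [iter, iterPos, iterNeg]
      · have h3 : ¬ (0 : ℤ) ≤ -((k : ℤ) + 1) + 1 := by omega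
        have h2 : (-(-((k : ℤ) + 1) + 1)).toNat = k := by omega
        simp only [iter, if_neg h3, h2]
    rw [e, e', Matrix.mul_nonsing_inv_cancel_left _ _ (isUnit_det_of_norm (hA _))]

/-- Invertibility of `A` lets the recurrence run backwards as well, so it determines the sequence on
all of `ℤ`. Iterates of derived cocycles are identified this way. -/
theorem eq_iter_of_recurrence (hA : ∀ ω, ‖(A ω).det‖ = 1) {ω : Ω} {I : ℤ → M2} (h0 : I 0 = 1)
    (h : ∀ n, I (n + 1) = A ((T ^ n) ω) * I n) (n : ℤ) : I n = iter T A n ω := by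
  induction n using Int.induction_on with
  | zero => rw [h0, iter_zero]
  | succ k ih => rw [h, ih, iter_add_one hA]
  | pred k ih =>
    have h1 := h (-(k : ℤ) - 1)
    have h2 := iter_add_one (T := T) hA (-(k : ℤ) - 1) ω
    rw [sub_add_cancel] at h1 h2
    rw [ih, h2] at h1
    have hu := isUnit_det_of_norm (hA ((T ^ (-(k : ℤ) - 1)) ω))
    have h3 := congrArg (fun X => (A ((T ^ (-(k : ℤ) - 1)) ω))⁻¹ * X) h1
    simp only [Matrix.nonsing_inv_mul_cancel_left _ _ hu] at h3
    exact h3.symm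

theorem norm_det_iter (hA : ∀ ω, ‖(A ω).det‖ = 1) (n : ℤ) (ω : Ω) :
    ‖(iter T A n ω).det‖ = 1 := by
  induction n using Int.induction_on with
  | zero => simp [iter_zero]
  | succ k ih => rw [iter_add_one hA, Matrix.det_mul, norm_mul, ih, hA, one_mul]
  | pred k ih =>
    have h2 := iter_add_one (T := T) hA (-(k : ℤ) - 1) ω
    rw [sub_add_cancel] at h2
    rwa [h2, Matrix.det_mul, norm_mul, hA, one_mul] at ih

theorem zpow_add_apply (T : Ω ≃ₜ Ω) (m n : ℤ) (ω : Ω) :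
    (T ^ (m + n)) ω = (T ^ m) ((T ^ n) ω) := by
  rw [zpow_add]; rfl

theorem iter_add (hA : ∀ ω, ‖(A ω).det‖ = 1) (m n : ℤ) (ω : Ω) :
    iter T A (m + n) ω = iter T A m ((T ^ n) ω) * iter T A n ω := by
  have hu := isUnit_det_of_norm (norm_det_iter (T := T) hA n ω)
  have := eq_iter_of_recurrence (T := T) (ω := (T ^ n) ω) hA
    (I := fun m => iter T A (m + n) ω * (iter T A n ω)⁻¹)
    (by simp [Matrix.mul_nonsing_inv _ hu])
    (fun k => by
      rw [add_right_comm, iter_add_one hA, zpow_add_apply, Matrix.mul_assoc]) m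
  rw [← this, Matrix.nonsing_inv_mul_cancel_right _ _ hu]

theorem act_iter_add (hA : ∀ ω, ‖(A ω).det‖ = 1) (m n : ℤ) (ω : Ω) (v : C2) :
    act (iter T A (m + n) ω) v = act (iter T A m ((T ^ n) ω)) (act (iter T A n ω) v) := by
  rw [iter_add hA, act_mul_apply]

theorem act_iter_add_one (hA : ∀ ω, ‖(A ω).det‖ = 1) (n : ℤ) (ω : Ω) (v : C2) :
    act (iter T A (n + 1) ω) v = act (A ((T ^ n) ω)) (act (iter T A n ω) v) := by
  rw [iter_add_one hA, act_mul_apply]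

theorem act_iter_zero (ω : Ω) (v : C2) : act (iter T A 0 ω) v = v := by
  rw [iter_zero, act_one]; rfl

theorem act_iter_neg_cancel (hA : ∀ ω, ‖(A ω).det‖ = 1) (n : ℤ) (ω : Ω) (v : C2) :
    act (iter T A (-n) ((T ^ n) ω)) (act (iter T A n ω) v) = v := by
  rw [← act_iter_add hA, neg_add_cancel, act_iter_zero]

theorem act_injective {M : M2} (h : ‖M.det‖ = 1) : Function.Injective (act M) := by
  intro v w hvw
  have := congrArg (act M⁻¹) hvw
  rwa [← act_mul_apply, ← act_mul_apply, Matrix.nonsing_inv_mul _ (isUnit_det_of_norm h),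
    act_one] at this

theorem act_ne_zero {M : M2} (h : ‖M.det‖ = 1) {v : C2} (hv : v ≠ 0) : act M v ≠ 0 :=
  fun h0 => hv (act_injective h (h0.trans (map_zero _).symm))

theorem continuous_zpow (T : Ω ≃ₜ Ω) (n : ℤ) : Continuous fun ω => (T ^ n) ω :=
  (T ^ n).continuous

theorem continuous_inv_of_norm_det (hc : Continuous A) (hA : ∀ ω, ‖(A ω).det‖ = 1) :
    Continuous fun ω => (A ω)⁻¹ := by
  simp only [Matrix.inv_def, Ring.inverse_eq_inv']
  exact (hc.matrix_det.inv₀ fun ω => (isUnit_det_of_norm (hA ω)).ne_zero).smul hc.matrix_adjugate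

theorem continuous_iter (hc : Continuous A) (hA : ∀ ω, ‖(A ω).det‖ = 1) (n : ℤ) :
    Continuous (iter T A n) := by
  induction n using Int.induction_on with
  | zero => simp only [funext (iter_zero (T := T) (A := A))]; exact continuous_const
  | succ k ih =>
    rw [funext (iter_add_one (T := T) hA (k : ℤ))]
    exact (hc.comp (continuous_zpow T _)).matrix_mul ih
  | pred k ih =>
    have e : iter T A (-(k : ℤ) - 1)
        = fun ω => (A ((T ^ (-(k : ℤ) - 1)) ω))⁻¹ * iter T A (-k) ω := by
      funext ω
      have h2 := iter_add_one (T := T) hA (-(k : ℤ) - 1) ω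
      rw [sub_add_cancel] at h2
      rw [h2, Matrix.nonsing_inv_mul_cancel_left _ _ (isUnit_det_of_norm (hA _))]
    rw [e]
    exact ((continuous_inv_of_norm_det hc hA).comp (continuous_zpow T _)).matrix_mul ih

theorem exists_norm_act_le [CompactSpace Ω] (hc : Continuous A) :
    ∃ K : ℝ, 1 ≤ K ∧ ∀ ω v, ‖act (A ω) v‖ ≤ K * ‖v‖ := by
  obtain ⟨C, hC⟩ := isCompact_univ.exists_bound_of_continuousOn
    (f := fun ω => act (A ω)) (continuous_act.comp hc).continuousOn
  refine ⟨max C 1, le_max_right _ _, fun ω v => ((act (A ω)).le_opNorm v).trans ?_⟩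
  gcongr
  exact (hC ω trivial).trans (le_max_left _ _)

theorem exists_norm_act_le_and_le [CompactSpace Ω] (hc : Continuous A)
    (hA : ∀ ω, ‖(A ω).det‖ = 1) :
    ∃ K : ℝ, 1 ≤ K ∧ (∀ ω v, ‖act (A ω) v‖ ≤ K * ‖v‖) ∧
      ∀ ω v, ‖v‖ ≤ K * ‖act (A ω) v‖ := by
  obtain ⟨K₁, hK₁, hb₁⟩ := exists_norm_act_le hc
  obtain ⟨K₂, hK₂, hb₂⟩ := exists_norm_act_le (continuous_inv_of_norm_det hc hA)
  refine ⟨max K₁ K₂, hK₁.trans (le_max_left _ _), fun ω v => (hb₁ ω v).trans ?_, fun ω v => ?_⟩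
  · gcongr
    exact le_max_left _ _
  · have := hb₂ ω (act (A ω) v)
    rw [← act_mul_apply, Matrix.nonsing_inv_mul _ (isUnit_det_of_norm (hA ω)), act_one] at this
    refine this.trans ?_
    gcongr
    exact le_max_right _ _

end Iterates

/-- Some orbit of a nonzero vector is bounded in both time directions. -/
def HasBoundedOrbit {Ω : Type*} [TopologicalSpace Ω] (T : Ω ≃ₜ Ω) (A : Ω → M2) : Prop :=
  ∃ (ω : Ω) (v : C2) (M : ℝ), v ≠ 0 ∧ ∀ n : ℤ, ‖act (iter T A n ω) v‖ ≤ M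

/-! ### Compactness: Sacker–Sell solutions and uniform doubling -/

section Compactness

variable {Ω : Type*} [TopologicalSpace Ω] {T : Ω ≃ₜ Ω} {A : Ω → M2}

theorem continuous_act_iter (hc : Continuous A) (hA : ∀ ω, ‖(A ω).det‖ = 1) (n : ℤ) :
    Continuous fun p : Ω × C2 => act (iter T A n p.1) p.2 :=
  (continuous_act.comp ((continuous_iter hc hA n).comp continuous_fst)).clm_apply continuous_snd

theorem nonempty_iInter_of_norm_eq_one [CompactSpace Ω] (S : ℕ → Set (Ω × C2))
    (hcl : ∀ k, IsClosed (S k))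
    (hanti : ∀ k, S (k + 1) ⊆ S k) (hne : ∀ k, (S k).Nonempty)
    (hS : ∀ k, ∀ p ∈ S k, ‖p.2‖ = 1) : (⋂ k, S k).Nonempty := by
  refine IsCompact.nonempty_iInter_of_sequence_nonempty_isCompact_isClosed S hanti hne ?_ hcl
  refine (isCompact_univ.prod (isCompact_sphere (0 : C2) 1)).of_isClosed_subset (hcl 0) ?_
  intro p hp
  simpa using hS 0 p hp

theorem act_iter_smul (n : ℤ) (ω : Ω) (c : ℂ) (v : C2) :
    act (iter T A n ω) (c • v) = c • act (iter T A n ω) v := map_smul _ _ _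

theorem norm_inv_smul_eq_one {v : C2} (hv : v ≠ 0) : ‖((‖v‖ : ℂ)⁻¹) • v‖ = 1 := by
  rw [norm_smul, norm_inv, Complex.norm_real, norm_norm, inv_mul_cancel₀ (norm_ne_zero_iff.mpr hv)]

theorem norm_inv_smul {v : C2} (w : C2) : ‖((‖v‖ : ℂ)⁻¹) • w‖ = ‖w‖ / ‖v‖ := by
  rw [norm_smul, norm_inv, Complex.norm_real, norm_norm, inv_mul_eq_div]

/-- The supremum `s` of the orbit norms need not be attained. Restarting at a time where the norm is
nearly `s` and normalizing gives a unit vector whose orbit stays below `1 + 1/(k+1)`; a limit point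
of such vectors stays below `1`. -/
theorem sackerSell_of_hasBoundedOrbit [CompactSpace Ω] (hc : Continuous A)
    (hA : ∀ ω, ‖(A ω).det‖ = 1) (h : HasBoundedOrbit T A) : SackerSell T A := by
  obtain ⟨ω, v, M, hv, hM⟩ := h
  set x : ℤ → ℝ := fun n => ‖act (iter T A n ω) v‖ with hx
  have hne : ∀ n, act (iter T A n ω) v ≠ 0 := fun n => act_ne_zero (norm_det_iter hA n ω) hv
  have hpos : ∀ n, 0 < x n := fun n => norm_pos_iff.mpr (hne n)
  have hb : BddAbove (Set.range x) := ⟨M, by rintro _ ⟨n, rfl⟩; exact hM n⟩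
  set s := ⨆ n, x n with hs
  have hle : ∀ n, x n ≤ s := fun n => le_ciSup hb n
  have hspos : 0 < s := (hpos 0).trans_le (hle 0)
  let S : ℕ → Set (Ω × C2) := fun k =>
    {p | ‖p.2‖ = 1 ∧ ∀ n : ℤ, ‖act (iter T A n p.1) p.2‖ ≤ 1 + 1 / ((k : ℝ) + 1)}
  obtain ⟨p, hp⟩ := nonempty_iInter_of_norm_eq_one S
    (fun k => by
      have e : S k = {p | ‖p.2‖ = 1} ∩ ⋂ n : ℤ,
          {p | ‖act (iter T A n p.1) p.2‖ ≤ 1 + 1 / ((k : ℝ) + 1)} := by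
        ext p; simp [S]
      rw [e]
      exact (isClosed_eq continuous_snd.norm continuous_const).inter (isClosed_iInter fun n =>
        isClosed_le (continuous_act_iter hc hA n).norm continuous_const))
    (fun k p hp => ⟨hp.1, fun n => (hp.2 n).trans (by push_cast; gcongr; linarith)⟩)
    (fun k => by
      have h1 : (1 : ℝ) < 1 + 1 / ((k : ℝ) + 1) := by
        have : (0 : ℝ) < 1 / ((k : ℝ) + 1) := by positivity
        linarith
      obtain ⟨m, hm⟩ := exists_lt_of_lt_ciSup (div_lt_self hspos h1)
      have hm' : s < x m * (1 + 1 / ((k : ℝ) + 1)) := (div_lt_iff₀ (by positivity)).mp hm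
      refine ⟨((T ^ m) ω, ((‖act (iter T A m ω) v‖ : ℂ)⁻¹) • act (iter T A m ω) v),
        norm_inv_smul_eq_one (hne m), fun n => ?_⟩
      simp only [act_iter_smul]
      rw [norm_inv_smul, ← act_iter_add hA, div_le_iff₀ (hpos m)]
      calc _ ≤ s := hle _
        _ ≤ _ := by rw [mul_comm]; exact hm'.le)
    (fun k p hp => hp.1)
  rw [Set.mem_iInter] at hp
  refine ⟨p.1, p.2, (hp 0).1, fun n => ?_⟩
  have ht : Filter.Tendsto (fun k : ℕ => 1 + 1 / ((k : ℝ) + 1)) Filter.atTop (𝓝 (1 + 0)) :=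
    tendsto_one_div_add_atTop_nhds_zero_nat.const_add 1
  rw [add_zero] at ht
  exact ge_of_tendsto' ht fun k => (hp k).2 n

theorem hasBoundedOrbit_iff_sackerSell [CompactSpace Ω] (hc : Continuous A)
    (hA : ∀ ω, ‖(A ω).det‖ = 1) : HasBoundedOrbit T A ↔ SackerSell T A := by
  refine ⟨sackerSell_of_hasBoundedOrbit hc hA, fun ⟨ω, v, hv, h⟩ => ⟨ω, v, 1, ?_, h⟩⟩
  rintro rfl
  simp at hv

/-- If no window worked, there would be unit vectors not exceeding norm `2` on longer and longer
windows, and a limit point would have a bounded orbit. -/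
theorem exists_doubling [CompactSpace Ω] (hc : Continuous A)
    (hA : ∀ ω, ‖(A ω).det‖ = 1) (h : ¬ HasBoundedOrbit T A) :
    ∃ N : ℕ, ∀ (ω : Ω) (v : C2), ∃ n : ℤ, |n| ≤ N ∧ 2 * ‖v‖ ≤ ‖act (iter T A n ω) v‖ := by
  by_contra! hcon
  apply h
  let S : ℕ → Set (Ω × C2) := fun k =>
    {p | ‖p.2‖ = 1 ∧ ∀ n : ℤ, |n| ≤ k → ‖act (iter T A n p.1) p.2‖ ≤ 2}
  obtain ⟨p, hp⟩ := nonempty_iInter_of_norm_eq_one S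
    (fun k => by
      have e : S k = {p | ‖p.2‖ = 1} ∩ ⋂ n : ℤ, ⋂ _ : |n| ≤ k,
          {p | ‖act (iter T A n p.1) p.2‖ ≤ 2} := by
        ext p; simp [S]
      rw [e]
      exact (isClosed_eq continuous_snd.norm continuous_const).inter (isClosed_iInter fun n =>
        isClosed_iInter fun _ =>
          isClosed_le (continuous_act_iter hc hA n).norm continuous_const))
    (fun k p hp => ⟨hp.1, fun n hn => hp.2 n (hn.trans (by push_cast; omega))⟩)
    (fun k => by
      obtain ⟨ω, v, hv⟩ := hcon k
      have hv0 : v ≠ 0 := by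
        rintro rfl
        simpa using hv 0 (by simp)
      refine ⟨(ω, ((‖v‖ : ℂ)⁻¹) • v), norm_inv_smul_eq_one hv0, fun n hn => ?_⟩
      simp only [act_iter_smul]
      rw [norm_inv_smul, div_le_iff₀ (norm_pos_iff.mpr hv0)]
      exact (hv n hn).le)
    (fun k p hp => hp.1)
  rw [Set.mem_iInter] at hp
  refine ⟨p.1, p.2, 2, ?_, fun n => (hp n.natAbs).2 n (by simp)⟩
  intro h0
  simpa [h0] using (hp 0).1

theorem exists_large_growth (hA : ∀ ω, ‖(A ω).det‖ = 1) {N : ℕ}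
    (hN : ∀ (ω : Ω) (v : C2), ∃ n : ℤ, |n| ≤ N ∧ 2 * ‖v‖ ≤ ‖act (iter T A n ω) v‖) (k : ℕ) :
    ∀ (ω : Ω) (v : C2), ∃ n : ℤ, |n| ≤ ((k * N : ℕ) : ℤ) ∧
      2 ^ k * ‖v‖ ≤ ‖act (iter T A n ω) v‖ := by
  induction k with
  | zero => exact fun ω v => ⟨0, by simp, by simp [act_iter_zero]⟩
  | succ k ih =>
    intro ω v
    obtain ⟨n, hn, h1⟩ := ih ω v
    obtain ⟨m, hm, h2⟩ := hN ((T ^ n) ω) (act (iter T A n ω) v)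
    refine ⟨m + n, ?_, ?_⟩
    · refine (abs_add_le m n).trans ?_
      push_cast at hn ⊢
      linarith
    · rw [act_iter_add hA, pow_succ]
      linarith

end Compactness

/-! ### Exponential growth excludes bounded orbits -/

section Growth

/-- The stretches have their minimum and both endpoint values comparable, with a ratio `R`
independent of the length. If `x` is bounded below on a half-line, the upper bound `M` suffices.
Otherwise `x` falls below any positive level in both directions, and the stretch between the first
such drops serves. -/
theorem exists_long_segment (x : ℤ → ℝ) {M K : ℝ} (hK : 1 ≤ K) (hpos : ∀ n, 0 < x n)
    (hM : ∀ n, x n ≤ M) (hs : ∀ n, x (n + 1) ≤ K * x n) (hs' : ∀ n, x n ≤ K * x (n + 1)) :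
    ∃ R : ℝ, 0 ≤ R ∧ ∀ l₀ : ℕ, ∃ (m : ℤ) (l : ℕ) (δ : ℝ), 0 < δ ∧ l₀ ≤ l ∧ x m ≤ R * δ ∧
      x (m + l) ≤ R * δ ∧ ∀ j : ℕ, j ≤ l → δ ≤ x (m + j) := by
  have hM0 : 0 < M := (hpos 0).trans_le (hM 0)
  by_cases h1 : ∃ δ > 0, ∀ n : ℕ, δ ≤ x n
  · obtain ⟨δ, hδ, h⟩ := h1
    refine ⟨M / δ, by positivity, fun l₀ => ⟨0, l₀, δ, hδ, le_rfl, ?_, ?_, ?_⟩⟩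
    · rw [div_mul_cancel₀ _ hδ.ne']; exact hM _
    · rw [div_mul_cancel₀ _ hδ.ne']; exact hM _
    · intro j _
      simpa using h j
  by_cases h2 : ∃ δ > 0, ∀ n : ℕ, δ ≤ x (-n)
  · obtain ⟨δ, hδ, h⟩ := h2
    refine ⟨M / δ, by positivity, fun l₀ => ⟨-l₀, l₀, δ, hδ, le_rfl, ?_, ?_, ?_⟩⟩
    · rw [div_mul_cancel₀ _ hδ.ne']; exact hM _
    · rw [div_mul_cancel₀ _ hδ.ne']; exact hM _
    · intro j hj
      have e : -(l₀ : ℤ) + j = -((l₀ - j : ℕ) : ℤ) := by omega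
      rw [e]; exact h _
  push Not at h1 h2
  have hK0 : 0 < K := by linarith
  refine ⟨K, hK0.le, fun l₀ => ?_⟩
  -- Taking the level to be the minimum over `[-l₀, l₀]` forces both drops below it to occur outside
  -- this window, so the stretch is long.
  obtain ⟨i₀, -, hi₀⟩ := Finset.exists_min_image (Finset.Icc (-(l₀ : ℤ)) l₀) x ⟨0, by simp⟩
  set δ := x i₀ with hδ
  have hδ0 : 0 < δ := hpos i₀
  classical
  set n₁ := Nat.find (h1 δ hδ0) with hn₁
  set n₂ := Nat.find (h2 δ hδ0) with hn₂
  have s₁ : x n₁ < δ := Nat.find_spec (h1 δ hδ0)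
  have s₂ : x (-n₂) < δ := Nat.find_spec (h2 δ hδ0)
  have m₁ : ∀ k < n₁, δ ≤ x k := fun k hk => not_lt.mp (Nat.find_min (h1 δ hδ0) hk)
  have m₂ : ∀ k < n₂, δ ≤ x (-k) := fun k hk => not_lt.mp (Nat.find_min (h2 δ hδ0) hk)
  have g₁ : l₀ < n₁ := by
    by_contra hcon
    exact absurd (hi₀ n₁ (by simp only [Finset.mem_Icc]; omega)) (not_le.mpr s₁)
  have g₂ : l₀ < n₂ := by
    by_contra hcon
    exact absurd (hi₀ (-n₂) (by simp only [Finset.mem_Icc]; omega)) (not_le.mpr s₂)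
  have hmid : ∀ i : ℤ, -(n₂ : ℤ) < i → i < n₁ → δ ≤ x i := by
    intro i hi hi'
    rcases le_or_gt 0 i with h | h
    · have := m₁ i.toNat (by omega)
      rwa [Int.toNat_of_nonneg h] at this
    · have := m₂ (-i).toNat (by omega)
      rwa [Int.toNat_of_nonneg (by omega), neg_neg] at this
  have hend : K * (δ / K) = δ := by field_simp
  -- The endpoints lie below `δ`, but their inner neighbours do not, so the one-step ratio keeps the
  -- endpoints above `δ / K`.
  refine ⟨-n₂, n₁ + n₂, δ / K, by positivity, by omega, by rw [hend]; exact s₂.le, ?_, ?_⟩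
  · rw [hend]
    have e : -(n₂ : ℤ) + ((n₁ + n₂ : ℕ) : ℤ) = n₁ := by push_cast; ring
    rw [e]; exact s₁.le
  · intro j hj
    rw [div_le_iff₀' hK0]
    rcases Nat.eq_zero_or_pos j with rfl | hj0
    · have := hs' (-(n₂ : ℤ))
      have h3 := hmid (-(n₂ : ℤ) + 1) (by omega) (by omega)
      simp only [Nat.cast_zero, add_zero]
      nlinarith [hs (-(n₂ : ℤ))]
    rcases hj.lt_or_eq with hj1 | rfl
    · have h3 := hmid (-(n₂ : ℤ) + j) (by omega) (by omega)
      nlinarith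
    · have e : -(n₂ : ℤ) + ((n₁ + n₂ : ℕ) : ℤ) = (n₁ - 1 : ℤ) + 1 := by push_cast; ring
      rw [e]
      exact (hmid (n₁ - 1) (by omega) (by omega)).trans (hs' _)

variable {Ω : Type*} [TopologicalSpace Ω] {T : Ω ≃ₜ Ω} {A : Ω → M2}

/-- The area spanned by the orbits of `v` and `w` is constant. Since the orbit of `v` has length at
least `δ`, the orbit of `w` stays within `D / δ` of the line through it. Its coefficient along that
line can then change only by a bounded amount per step, which gives growth linear in `l`. -/
theorem norm_iter_le_of_segment (hA : ∀ ω, ‖(A ω).det‖ = 1) {K R δ : ℝ} (hK0 : 0 ≤ K)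
    (hK : ∀ ω v, ‖act (A ω) v‖ ≤ K * ‖v‖) (hδ : 0 < δ) {l : ℕ} {ω : Ω} {v : C2} (hv : v ≠ 0)
    (h0 : ‖v‖ ≤ R * δ) (hl : ‖act (iter T A l ω) v‖ ≤ R * δ)
    (hseg : ∀ j : ℕ, j ≤ l → δ ≤ ‖act (iter T A j ω) v‖) :
    ‖act (iter T A l ω)‖ ≤ 3 * R + l * ((1 + K) * R ^ 2) := by
  have hv0 : δ ≤ ‖v‖ := by simpa [act_iter_zero] using hseg 0 (Nat.zero_le _)
  have hR : 1 ≤ R := by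
    by_contra! hcon
    nlinarith
  refine ContinuousLinearMap.opNorm_le_bound _ (by positivity) fun w => ?_
  set D := ‖cross v w‖ with hD
  have hDw : D ≤ ‖v‖ * ‖w‖ := norm_cross_le v w
  have hD0 : 0 ≤ D := norm_nonneg _
  have hne : ∀ n : ℤ, act (iter T A n ω) v ≠ 0 := fun n => act_ne_zero (norm_det_iter hA n ω) hv
  -- `c n` is the coefficient of the projection of the orbit of `w` onto that of `v` at time `n`.
  choose c hc using fun n : ℤ => exists_smul_near (hne n) (act (iter T A n ω) w)
  have hc' : ∀ n : ℤ, ‖act (iter T A n ω) v‖ *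
      ‖act (iter T A n ω) w - c n • act (iter T A n ω) v‖ = D := fun n => by
    rw [hc, cross_act, norm_mul, norm_det_iter hA, one_mul]
  have herr : ∀ j : ℕ, j ≤ l →
      ‖act (iter T A j ω) w - c j • act (iter T A j ω) v‖ ≤ D / δ := fun j hj => by
    rw [le_div_iff₀ hδ, ← hc' j, mul_comm]
    gcongr
    exact hseg j hj
  have hstep : ∀ j : ℕ, j + 1 ≤ l → ‖c (j + 1 : ℕ) - c j‖ * δ ≤ (1 + K) * (D / δ) := by
    intro j hj
    have e1 := herr j (by omega)
    have e2 := herr (j + 1) hj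
    have e3 : ‖(c (j + 1 : ℕ) - c j) • act (iter T A (j + 1 : ℕ) ω) v‖ ≤ D / δ + K * (D / δ) := by
      have : (c (j + 1 : ℕ) - c j) • act (iter T A (j + 1 : ℕ) ω) v
          = act (A ((T ^ (j : ℤ)) ω)) (act (iter T A j ω) w - c j • act (iter T A j ω) v)
            - (act (iter T A (j + 1 : ℕ) ω) w
              - c (j + 1 : ℕ) • act (iter T A (j + 1 : ℕ) ω) v) := by
        rw [map_sub, map_smul]
        push_cast
        rw [act_iter_add_one hA, act_iter_add_one hA, sub_smul]
        abel
      rw [this]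
      refine (norm_sub_le _ _).trans ?_
      rw [add_comm]
      refine add_le_add e2 ((hK _ _).trans ?_)
      gcongr
    rw [norm_smul] at e3
    calc _ ≤ ‖c (j + 1 : ℕ) - c j‖ * ‖act (iter T A (j + 1 : ℕ) ω) v‖ := by
          gcongr; exact hseg _ hj
      _ ≤ _ := by linarith
  have hc0 : ‖c 0‖ * δ ≤ 2 * ‖w‖ := by
    have e1 := herr 0 (Nat.zero_le _)
    have e4 := hc' 0
    simp only [act_iter_zero] at e4
    have e5 : ‖w - c 0 • v‖ ≤ ‖w‖ := by
      have : 0 < ‖v‖ := norm_pos_iff.mpr hv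
      nlinarith
    have e6 : ‖c 0 • v‖ ≤ 2 * ‖w‖ := by
      have : c 0 • v = w - (w - c 0 • v) := by abel
      rw [this]
      refine (norm_sub_le _ _).trans (by linarith)
    rw [norm_smul] at e6
    refine le_trans ?_ e6
    gcongr
  have hcj : ∀ j : ℕ, j ≤ l → ‖c j‖ * δ ≤ 2 * ‖w‖ + j * ((1 + K) * (D / δ)) := by
    intro j
    induction j with
    | zero => intro _; simpa using hc0
    | succ j ih =>
      intro hj
      have i1 := ih (by omega)
      have i2 := hstep j hj
      have i3 : ‖c (j + 1 : ℕ)‖ ≤ ‖c j‖ + ‖c (j + 1 : ℕ) - c j‖ := by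
        have : c (j + 1 : ℕ) = c j + (c (j + 1 : ℕ) - c j) := by abel
        conv_lhs => rw [this]
        exact norm_add_le _ _
      push_cast at *
      nlinarith
  have hDδ : D / δ ≤ R * ‖w‖ := by
    rw [div_le_iff₀ hδ]
    nlinarith [norm_nonneg w]
  have hfin : ‖act (iter T A l ω) w‖
      ≤ ‖c l‖ * ‖act (iter T A l ω) v‖ + D / δ := by
    have : act (iter T A l ω) w
        = c l • act (iter T A l ω) v + (act (iter T A l ω) w - c l • act (iter T A l ω) v) := by
      abel
    rw [this]
    refine (norm_add_le _ _).trans ?_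
    rw [norm_smul]
    exact add_le_add le_rfl (herr l le_rfl)
  have h7 : ‖c l‖ * ‖act (iter T A l ω) v‖ ≤ R * (2 * ‖w‖ + l * ((1 + K) * (R * ‖w‖))) := by
    calc _ ≤ ‖c l‖ * (R * δ) := by gcongr
      _ = R * (‖c l‖ * δ) := by ring
      _ ≤ R * (2 * ‖w‖ + l * ((1 + K) * (D / δ))) := by
        gcongr
        exact hcj l le_rfl
      _ ≤ _ := by gcongr
  calc _ ≤ R * (2 * ‖w‖ + l * ((1 + K) * (R * ‖w‖))) + R * ‖w‖ := by linarith
    _ = _ := by ring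

theorem not_hasBoundedOrbit_of_growth [CompactSpace Ω] (hc : Continuous A)
    (hA : ∀ ω, ‖(A ω).det‖ = 1) (h : UniformExpGrowth T A) : ¬ HasBoundedOrbit T A := by
  rintro ⟨ω, v, M, hv, hM⟩
  obtain ⟨C, L, hC, hL, hgrow⟩ := h
  obtain ⟨K, hK1, hKA, hKI⟩ := exists_norm_act_le_and_le hc hA
  have hne : ∀ n : ℤ, act (iter T A n ω) v ≠ 0 := fun n => act_ne_zero (norm_det_iter hA n ω) hv
  obtain ⟨R, hR, hseg⟩ := exists_long_segment (fun n => ‖act (iter T A n ω) v‖) hK1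
    (fun n => norm_pos_iff.mpr (hne n)) hM
    (fun n => by simp only [act_iter_add_one hA]; exact hKA _ _)
    (fun n => by simp only [act_iter_add_one hA]; exact hKI _ _)
  have hlin : ∀ l₀ : ℕ, ∃ l : ℕ, l₀ ≤ l ∧ C * L ^ l ≤ 3 * R + l * ((1 + K) * R ^ 2) := by
    intro l₀
    obtain ⟨m, l, δ, hδ, hl, e0, e1, e2⟩ := hseg l₀
    refine ⟨l, hl, ?_⟩
    have hcomp : ∀ j : ℕ, act (iter T A (m + j) ω) v
        = act (iter T A j ((T ^ m) ω)) (act (iter T A m ω) v) := fun j => by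
      rw [add_comm, act_iter_add hA]
    simp only [hcomp] at e1 e2
    have := norm_iter_le_of_segment hA (by linarith) hKA hδ (hne m) e0 e1 e2
    have hg := hgrow l ((T ^ m) ω)
    rw [abs_of_nonneg (Int.natCast_nonneg l), zpow_natCast] at hg
    exact hg.trans this
  have t1 := tendsto_pow_const_div_const_pow_of_one_lt 0 hL
  have t2 := tendsto_pow_const_div_const_pow_of_one_lt 1 hL
  have t3 := (t1.const_mul (3 * R)).add (t2.const_mul ((1 + K) * R ^ 2))
  simp only [mul_zero, add_zero] at t3
  obtain ⟨l₀, hl₀⟩ := Filter.eventually_atTop.mp (t3.eventually (gt_mem_nhds hC))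
  obtain ⟨l, hl, hle⟩ := hlin l₀
  have hLl : 0 < L ^ l := by positivity
  have := hl₀ l hl
  rw [← mul_div_assoc, ← mul_div_assoc, ← add_div, div_lt_iff₀ hLl] at this
  simp only [pow_zero, pow_one] at this
  nlinarith

end Growth

/-! ### An exponential splitting excludes bounded orbits -/

section Splitting

variable {Ω : Type*} [TopologicalSpace Ω] {T : Ω ≃ₜ Ω} {A : Ω → M2}

theorem act_iter_mem {Λ : Ω → ℙ ℂ C2} (hA : ∀ ω, ‖(A ω).det‖ = 1)
    (h : ∀ ω, (Λ ω).submodule.map (act (A ω)).toLinearMap = (Λ (T ω)).submodule) (n : ℤ) {ω : Ω}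
    {v : C2} (hv : v ∈ (Λ ω).submodule) :
    act (iter T A n ω) v ∈ (Λ ((T ^ n) ω)).submodule := by
  have hT : ∀ k : ℤ, (T ^ (k + 1)) ω = T ((T ^ k) ω) := fun k => by
    rw [add_comm, zpow_add_apply, zpow_one]
  induction n using Int.induction_on with
  | zero => rw [act_iter_zero]; simpa using hv
  | succ k ih =>
    rw [act_iter_add_one hA, hT, ← h]
    exact Submodule.mem_map_of_mem ih
  | pred k ih =>
    have e := act_iter_add_one (T := T) hA (-(k : ℤ) - 1) ω v
    have e2 := hT (-(k : ℤ) - 1)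
    rw [sub_add_cancel] at e e2
    rw [e2, ← h, e] at ih
    obtain ⟨u, hu, huv⟩ := ih
    rwa [← act_injective (hA _) huv]

theorem eq_zero_of_le_mul_inv_pow {L C x : ℝ} (hL : 1 < L) (hx : 0 ≤ x)
    (h : ∀ n : ℕ, 0 < n → x ≤ C * (L ^ n)⁻¹) : x = 0 := by
  refine le_antisymm ?_ hx
  have t : Filter.Tendsto (fun n : ℕ => C * (L ^ n)⁻¹) Filter.atTop (𝓝 (C * 0)) :=
    (tendsto_inv_atTop_zero.comp (tendsto_pow_atTop_atTop_of_one_lt hL)).const_mul C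
  rw [mul_zero] at t
  exact ge_of_tendsto t ((Filter.eventually_gt_atTop 0).mono fun n hn => h n hn)

theorem not_hasBoundedOrbit_of_splitting (hA : ∀ ω, ‖(A ω).det‖ = 1)
    (h : InvariantExpSplitting T A) : ¬ HasBoundedOrbit T A := by
  rintro ⟨ω, v, M, hv, hM⟩
  obtain ⟨c, L, Λs, Λu, hc, hL, -, -, hinv, hexp⟩ := h
  have hfu : ∀ n : ℕ, 0 < n → ∀ x ∈ (Λu ω).submodule,
      ‖x‖ ≤ c * (L ^ n)⁻¹ * ‖act (iter T A n ω) x‖ := fun n hn x hx => by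
    have := (hexp n hn ((T ^ (n : ℤ)) ω)).2 _ (act_iter_mem hA (fun ω => (hinv ω).2) n hx)
    rwa [act_iter_neg_cancel hA] at this
  have hbs : ∀ n : ℕ, 0 < n → ∀ x ∈ (Λs ω).submodule,
      ‖x‖ ≤ c * (L ^ n)⁻¹ * ‖act (iter T A (-n) ω) x‖ := fun n hn x hx => by
    have := (hexp n hn ((T ^ (-(n : ℤ))) ω)).1 _ (act_iter_mem hA (fun ω => (hinv ω).1) (-n) hx)
    have e := act_iter_neg_cancel (T := T) hA (-(n : ℤ)) ω x
    rw [neg_neg] at e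
    rwa [e] at this
  obtain ⟨s, hs, hs0⟩ := Submodule.exists_mem_ne_zero_of_ne_bot
    (p := (Λs ω).submodule) (by
      intro h0
      have := (Λs ω).finrank_submodule
      rw [h0, finrank_bot] at this
      exact zero_ne_one this)
  obtain ⟨u, hu, hu0⟩ := Submodule.exists_mem_ne_zero_of_ne_bot
    (p := (Λu ω).submodule) (by
      intro h0
      have := (Λu ω).finrank_submodule
      rw [h0, finrank_bot] at this
      exact zero_ne_one this)
  have hpow : ∀ n : ℕ, (L ^ n)⁻¹ ≤ 1 := fun n => inv_le_one_of_one_le₀ (one_le_pow₀ hL.le)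
  have hLn : ∀ n : ℕ, 0 < (L ^ n)⁻¹ := fun n => by positivity
  -- The two lines differ: a common vector would be both contracted and expanded by forward
  -- iteration, hence zero.
  have hcr : cross u s ≠ 0 := by
    intro h0
    obtain ⟨a, ha⟩ := exists_smul_near hu0 s
    rw [h0, norm_zero, mul_eq_zero, norm_eq_zero, norm_eq_zero, sub_eq_zero] at ha
    have hsu : s ∈ (Λu ω).submodule := by
      rw [ha.resolve_left hu0]
      exact Submodule.smul_mem _ _ hu
    apply hs0
    rw [← norm_eq_zero]
    refine eq_zero_of_le_mul_inv_pow (C := c * c * ‖s‖) hL (norm_nonneg _) fun n hn => ?_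
    have e1 := hfu n hn s hsu
    have e2 := (hexp n hn ω).1 s hs
    calc _ ≤ c * (L ^ n)⁻¹ * (c * (L ^ n)⁻¹ * ‖s‖) := e1.trans (by gcongr)
      _ ≤ c * (L ^ n)⁻¹ * (c * 1 * ‖s‖) := by gcongr; exact hpow n
      _ = _ := by ring
  obtain ⟨a, b, hab⟩ := eq_combination hcr v
  have hau := Submodule.smul_mem (Λu ω).submodule a hu
  have hbsm := Submodule.smul_mem (Λs ω).submodule b hs
  set p := a • u with hp
  set q := b • s with hq
  -- Forward in time the stable part stays bounded, so the unstable part `p` has a bounded forward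
  -- orbit although it is expanded; `q` is treated symmetrically in backward time.
  have hp0 : p = 0 := by
    rw [← norm_eq_zero]
    refine eq_zero_of_le_mul_inv_pow (C := c * (M + c * ‖q‖)) hL (norm_nonneg _) fun n hn => ?_
    have e1 := hfu n hn p hau
    have e2 := (hexp n hn ω).1 q hbsm
    have e3 : ‖act (iter T A n ω) p‖ ≤ M + c * ‖q‖ := by
      have : act (iter T A n ω) p = act (iter T A n ω) v - act (iter T A n ω) q := by
        rw [hab, map_add]; abel
      rw [this]
      refine (norm_sub_le _ _).trans (add_le_add (hM n) (e2.trans ?_))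
      gcongr
      exact mul_le_of_le_one_right hc.le (hpow n)
    calc _ ≤ c * (L ^ n)⁻¹ * (M + c * ‖q‖) := e1.trans (by gcongr)
      _ = _ := by ring
  have hq0 : q = 0 := by
    rw [← norm_eq_zero]
    refine eq_zero_of_le_mul_inv_pow (C := c * (M + c * ‖p‖)) hL (norm_nonneg _) fun n hn => ?_
    have e1 := hbs n hn q hbsm
    have e2 := (hexp n hn ω).2 p hau
    have e3 : ‖act (iter T A (-n) ω) q‖ ≤ M + c * ‖p‖ := by
      have : act (iter T A (-n) ω) q = act (iter T A (-n) ω) v - act (iter T A (-n) ω) p := by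
        rw [hab, map_add]; abel
      rw [this]
      refine (norm_sub_le _ _).trans (add_le_add (hM _) (e2.trans ?_))
      gcongr
      exact mul_le_of_le_one_right hc.le (hpow n)
    calc _ ≤ c * (L ^ n)⁻¹ * (M + c * ‖p‖) := e1.trans (by gcongr)
      _ = _ := by ring
  exact hv (by rw [hab, hp0, hq0, add_zero])

/-- The definition is a disjunction, so the converse needs only its last alternative; growth and
splitting never have to be constructed. -/
theorem uniformlyHyperbolic_iff [CompactSpace Ω] (hc : Continuous A)
    (hA : ∀ ω, ‖(A ω).det‖ = 1) : UniformlyHyperbolic T A ↔ ¬ HasBoundedOrbit T A := by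
  constructor
  · rintro (h | h | h)
    · exact not_hasBoundedOrbit_of_growth hc hA h
    · exact not_hasBoundedOrbit_of_splitting hA h
    · rwa [hasBoundedOrbit_iff_sackerSell hc hA]
  · intro h
    rw [hasBoundedOrbit_iff_sackerSell hc hA] at h
    exact Or.inr (Or.inr h)

end Splitting

/-! ### Second iterates and unimodular multiples -/

section SecondIterate

variable {Ω : Type*} [TopologicalSpace Ω] {T : Ω ≃ₜ Ω} {A : Ω → M2}

theorem sq_zpow_apply (T : Ω ≃ₜ Ω) (n : ℤ) (ω : Ω) : ((T ^ 2) ^ n) ω = (T ^ (2 * n)) ω := by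
  rw [zpow_mul]; rfl

theorem iter_iter_two (hA : ∀ ω, ‖(A ω).det‖ = 1) (n : ℤ) (ω : Ω) :
    iter (T ^ 2) (iter T A 2) n ω = iter T A (2 * n) ω := by
  refine (eq_iter_of_recurrence (I := fun n => iter T A (2 * n) ω) (norm_det_iter hA 2)
    (iter_zero ω) (fun k => ?_) n).symm
  rw [sq_zpow_apply, ← iter_add hA]
  congr 1
  ring

theorem hasBoundedOrbit_iter_two [CompactSpace Ω] (hc : Continuous A)
    (hA : ∀ ω, ‖(A ω).det‖ = 1) :
    HasBoundedOrbit (T ^ 2) (iter T A 2) ↔ HasBoundedOrbit T A := by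
  constructor
  · rintro ⟨ω, v, M, hv, h⟩
    obtain ⟨K, hK, hb⟩ := exists_norm_act_le hc
    have hM : 0 ≤ M := (norm_nonneg _).trans (h 0)
    simp only [iter_iter_two hA] at h
    refine ⟨ω, v, K * M, hv, fun n => ?_⟩
    rcases Int.even_or_odd' n with ⟨k, rfl | rfl⟩
    · exact (h k).trans (le_mul_of_one_le_left hM hK)
    · rw [act_iter_add_one hA]
      exact (hb _ _).trans (by gcongr; exact h k)
  · rintro ⟨ω, v, M, hv, h⟩
    exact ⟨ω, v, M, hv, fun n => by rw [iter_iter_two hA]; exact h _⟩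

theorem norm_det_smul {c : ℂ} (hc : ‖c‖ = 1) {M : M2} (hM : ‖M.det‖ = 1) :
    ‖(c • M).det‖ = 1 := by
  rw [Matrix.det_smul, norm_mul, norm_pow, hc, hM]; simp

theorem iter_smul (hA : ∀ ω, ‖(A ω).det‖ = 1) {c : ℂ} (hc : ‖c‖ = 1) (n : ℤ) (ω : Ω) :
    iter T (fun ω => c • A ω) n ω = c ^ n • iter T A n ω := by
  have hc0 : c ≠ 0 := by
    rintro rfl
    simp at hc
  refine (eq_iter_of_recurrence (I := fun n => c ^ n • iter T A n ω)
    (fun ω => norm_det_smul hc (hA ω)) (by simp [iter_zero]) (fun k => ?_) n).symm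
  simp only [iter_add_one hA, zpow_add_one₀ hc0, Matrix.smul_mul, Matrix.mul_smul, smul_smul]

theorem hasBoundedOrbit_smul (hA : ∀ ω, ‖(A ω).det‖ = 1) {c : ℂ} (hc : ‖c‖ = 1) :
    HasBoundedOrbit T (fun ω => c • A ω) ↔ HasBoundedOrbit T A := by
  have e : ∀ n ω v, ‖act (iter T (fun ω => c • A ω) n ω) v‖ = ‖act (iter T A n ω) v‖ := by
    intro n ω v
    rw [iter_smul hA hc, act_smul, smul_apply, norm_smul, norm_zpow, hc,
      one_zpow, one_mul]
  simp only [HasBoundedOrbit, e]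

end SecondIterate

/-! ### The Szegő and Gesztesy–Zinchenko cocycles -/

section SzegoCocycle

theorem rho_pos (α : 𝔻) : 0 < rho α := by
  have h := α.norm_lt_one
  exact Real.sqrt_pos.mpr (by nlinarith [norm_nonneg (α : ℂ)])

theorem rho_sq (α : 𝔻) : (rho α : ℂ) ^ 2 = 1 - conj (α : ℂ) * α := by
  have h := α.norm_lt_one
  rw [Complex.conj_mul', ← Complex.ofReal_pow, rho,
    Real.sq_sqrt (by nlinarith [norm_nonneg (α : ℂ)])]
  push_cast
  rfl

theorem rho_ne_zero (α : 𝔻) : (rho α : ℂ) ≠ 0 := by exact_mod_cast (rho_pos α).ne'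

theorem norm_det_szego (α : 𝔻) {z : ℂ} (hz : ‖z‖ = 1) : ‖(szego α z).det‖ = 1 := by
  have h : (szego α z).det = z := by
    rw [szego, Matrix.det_smul, Matrix.det_fin_two_of, Fintype.card_fin, inv_pow, rho_sq]
    have := rho_sq α ▸ pow_ne_zero 2 (rho_ne_zero α)
    field_simp
  rw [h, hz]

/-- With `W = [[0, z⁻¹], [1, 0]]` one has `P(α) = W S(α)` and `Q(β) = z⁻¹ S(β) W⁻¹`, so `W` cancels.
-/
theorem gzQ_mul_gzP (α β : 𝔻) {z : ℂ} (hz : z ≠ 0) :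
    gzQ β z * gzP α z = z⁻¹ • (szego β z * szego α z) := by
  ext i j
  fin_cases i <;> fin_cases j <;>
    simp [gzQ, gzP, szego, Matrix.mul_apply, Fin.sum_univ_two] <;> field_simp <;> ring

variable {Ω : Type*} [TopologicalSpace Ω] {T : Ω ≃ₜ Ω} {f : Ω → 𝔻}

theorem continuous_rho_inv (hf : Continuous f) : Continuous fun ω => (rho (f ω))⁻¹ := by
  refine Continuous.inv₀ ?_ fun ω => (rho_pos _).ne'
  unfold rho
  have : Continuous fun ω => (f ω : ℂ) := Complex.UnitDisc.continuous_coe.comp hf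
  fun_prop

theorem continuous_szegoMap (hf : Continuous f) (z : ℂ) : Continuous (szegoMap f z) := by
  have h1 : Continuous fun ω => (f ω : ℂ) := Complex.UnitDisc.continuous_coe.comp hf
  have h2 : Continuous fun ω => ((rho (f ω) : ℂ))⁻¹ := by
    have := Complex.continuous_ofReal.comp (continuous_rho_inv hf)
    simpa only [Function.comp_def, Complex.ofReal_inv] using this
  unfold szegoMap szego
  refine h2.smul (continuous_matrix fun i j => ?_)
  fin_cases i <;> fin_cases j <;> simp <;> fun_prop

theorem iter_two (A : Ω → M2) (ω : Ω) : iter T A 2 ω = A (T ω) * A ω := by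
  simp [iter, iterPos]

theorem gzMap_eq {z : ℂ} (hz : z ≠ 0) :
    gzMap T f z = fun ω => z⁻¹ • iter T (szegoMap f z) 2 ω := by
  funext ω
  rw [gzMap, gzQ_mul_gzP _ _ hz, iter_two]
  rfl

theorem uniformlyHyperbolic_szego_iff [CompactSpace Ω] (hf : Continuous f) {z : ℂ}
    (hz : ‖z‖ = 1) :
    (UniformlyHyperbolic T (szegoMap f z) ↔
      UniformlyHyperbolic (T ^ 2) (iter T (szegoMap f z) 2)) ∧
    (UniformlyHyperbolic T (szegoMap f z) ↔ UniformlyHyperbolic (T ^ 2) (gzMap T f z)) := by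
  have hz0 : z ≠ 0 := by
    rintro rfl
    simp at hz
  have hzi : ‖z⁻¹‖ = 1 := by rw [norm_inv, hz, inv_one]
  have hA : ∀ ω, ‖(szegoMap f z ω).det‖ = 1 := fun ω => norm_det_szego _ hz
  have hc := continuous_szegoMap hf z
  have hA2 : ∀ ω, ‖(iter T (szegoMap f z) 2 ω).det‖ = 1 := norm_det_iter hA 2
  have hc2 := continuous_iter (T := T) hc hA 2
  have e1 := uniformlyHyperbolic_iff (T := T) hc hA
  have e2 := uniformlyHyperbolic_iff (T := T ^ 2) hc2 hA2
  have e3 := uniformlyHyperbolic_iff (T := T ^ 2)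
    (A := fun ω => z⁻¹ • iter T (szegoMap f z) 2 ω) (hc2.const_smul z⁻¹)
    fun ω => norm_det_smul hzi (hA2 ω)
  have e4 := hasBoundedOrbit_smul (T := T ^ 2) hA2 hzi
  have e5 := hasBoundedOrbit_iter_two (T := T) hc hA
  rw [gzMap_eq hz0]
  exact ⟨(e1.trans (not_congr e5.symm)).trans e2.symm,
    (e1.trans (not_congr (e4.trans e5).symm)).trans e3.symm⟩

end SzegoCocycle

/-! ### Approximate orbits in `ℓ²` -/

section Perturbed

variable {Ω : Type*} [TopologicalSpace Ω] {T : Ω ≃ₜ Ω} {A : Ω → M2}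

/-- A discrete Gronwall estimate in both time directions: each one-step error is magnified by at
most `K` per further step. -/
theorem norm_sub_iter_le (hA : ∀ ω, ‖(A ω).det‖ = 1) {K : ℝ} (hK : 1 ≤ K)
    (hb : ∀ ω v, ‖act (A ω) v‖ ≤ K * ‖v‖) (hb' : ∀ ω v, ‖v‖ ≤ K * ‖act (A ω) v‖) {ω : Ω}
    {y : ℤ → C2} {e : ℤ → ℝ} (hy : ∀ n, ‖y (n + 1) - act (A ((T ^ n) ω)) (y n)‖ ≤ e n)
    {N : ℕ} {p : ℤ} {E : ℝ} (hE : ∀ j : ℤ, |j| ≤ N → e (p + j) ≤ E) {n : ℤ} (hn : |n| ≤ N) :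
    ‖y (p + n) - act (iter T A n ((T ^ p) ω)) (y p)‖ ≤ N * K ^ N * E := by
  have hE0 : 0 ≤ E := ((norm_nonneg _).trans (hy _)).trans (hE 0 (by simp))
  have hK0 : 0 ≤ K := by linarith
  have hpos : ∀ k : ℕ, k ≤ N →
      ‖y (p + k) - act (iter T A k ((T ^ p) ω)) (y p)‖ ≤ k * K ^ k * E := by
    intro k
    induction k with
    | zero => intro _; simp [act_iter_zero]
    | succ k ih =>
      intro hk
      have i1 := ih (by omega)
      have i2 := (hy (p + k)).trans (hE k (by rw [abs_of_nonneg] <;> omega))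
      have i3 := hb ((T ^ (p + k)) ω) (y (p + k) - act (iter T A k ((T ^ p) ω)) (y p))
      have e1 : y (p + (k + 1 : ℕ)) - act (iter T A (k + 1 : ℕ) ((T ^ p) ω)) (y p)
          = (y (p + k + 1) - act (A ((T ^ (p + k)) ω)) (y (p + k)))
            + act (A ((T ^ (p + k)) ω)) (y (p + k) - act (iter T A k ((T ^ p) ω)) (y p)) := by
        push_cast
        rw [act_iter_add_one hA, map_sub, ← zpow_add_apply, add_comm (k : ℤ) p, add_assoc]
        abel
      rw [e1]
      refine (norm_add_le _ _).trans ?_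
      have i4 : 1 ≤ K ^ (k + 1) := one_le_pow₀ hK
      calc _ ≤ E + K * (k * K ^ k * E) := add_le_add i2 (i3.trans (by gcongr))
        _ ≤ K ^ (k + 1) * E + K * (k * K ^ k * E) := by gcongr; nlinarith
        _ = _ := by push_cast; ring
  have hneg : ∀ k : ℕ, k ≤ N →
      ‖y (p + -k) - act (iter T A (-k) ((T ^ p) ω)) (y p)‖ ≤ k * K ^ k * E := by
    intro k
    induction k with
    | zero => intro _; simp [act_iter_zero]
    | succ k ih =>
      intro hk
      have i1 := ih (by omega)
      have i2 := (hy (p + (-(k : ℤ) - 1))).trans (hE _ (by rw [abs_of_neg] <;> omega))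
      have i3 := hb' ((T ^ (p + (-(k : ℤ) - 1))) ω)
        (y (p + (-(k : ℤ) - 1)) - act (iter T A (-(k : ℤ) - 1) ((T ^ p) ω)) (y p))
      have e0 : (-((k + 1 : ℕ) : ℤ)) = -(k : ℤ) - 1 := by push_cast; ring
      have e2 := act_iter_add_one (T := T) hA (-(k : ℤ) - 1) ((T ^ p) ω) (y p)
      rw [sub_add_cancel, ← zpow_add_apply, add_comm _ p] at e2
      have e1 : act (A ((T ^ (p + (-(k : ℤ) - 1))) ω))
            (y (p + (-(k : ℤ) - 1)) - act (iter T A (-(k : ℤ) - 1) ((T ^ p) ω)) (y p))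
          = (y (p + -k) - act (iter T A (-k) ((T ^ p) ω)) (y p))
            - (y (p + (-(k : ℤ) - 1) + 1)
              - act (A ((T ^ (p + (-(k : ℤ) - 1))) ω)) (y (p + (-(k : ℤ) - 1)))) := by
        rw [e2, map_sub, add_assoc, sub_add_cancel]
        abel
      rw [e0]
      refine i3.trans ?_
      rw [e1]
      have i4 : 1 ≤ K ^ k := one_le_pow₀ hK
      calc _ ≤ K * (k * K ^ k * E + E) := by
            gcongr
            exact (norm_sub_le _ _).trans (add_le_add i1 i2)
        _ ≤ K * (k * K ^ k * E + K ^ k * E) := by gcongr; nlinarith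
        _ = _ := by push_cast; ring
  have hfin : ∀ k : ℕ, k ≤ N → (k : ℝ) * K ^ k * E ≤ N * K ^ N * E := fun k hk => by gcongr
  rcases le_or_gt 0 n with h | h
  · obtain ⟨k, rfl⟩ := Int.eq_ofNat_of_zero_le h
    rw [abs_of_nonneg h] at hn
    exact (hpos k (by omega)).trans (hfin k (by omega))
  · obtain ⟨k, rfl⟩ : ∃ k : ℕ, n = -k := ⟨(-n).toNat, by omega⟩
    rw [abs_of_neg h] at hn
    exact (hneg k (by omega)).trans (hfin k (by omega))

theorem hasSum_add_right {g : ℤ → ℝ} {a : ℝ} (h : HasSum g a) (j : ℤ) :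
    HasSum (fun p => g (p + j)) a :=
  (Equiv.addRight j).hasSum_iff.mpr h

/-- Doubling `k` times gives `M ^ 2 = 4 ^ k` on a window growing only linearly in `k`. The surplus
`1` is what allows absorption when the squares are summed. -/
theorem exists_growth_gt_length [CompactSpace Ω] (hc : Continuous A)
    (hA : ∀ ω, ‖(A ω).det‖ = 1) (h : ¬ HasBoundedOrbit T A) :
    ∃ (N : ℕ) (M : ℝ), 0 ≤ M ∧ 2 * (2 * N + 1) + 1 ≤ M ^ 2 ∧
      ∀ (ω : Ω) (v : C2), ∃ n : ℤ, |n| ≤ N ∧ M * ‖v‖ ≤ ‖act (iter T A n ω) v‖ := by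
  obtain ⟨N, hN⟩ := exists_doubling hc hA h
  have t := (tendsto_pow_const_div_const_pow_of_one_lt 1 (r := (4 : ℝ)) (by norm_num)).const_mul
    (4 * (N : ℝ))
  have t' := (tendsto_pow_const_div_const_pow_of_one_lt 0 (r := (4 : ℝ)) (by norm_num)).const_mul
    (3 : ℝ)
  have t2 := t.add t'
  simp only [mul_zero, add_zero] at t2
  obtain ⟨k, hk⟩ := (t2.eventually (gt_mem_nhds (show (0 : ℝ) < 1 by norm_num))).exists
  rw [← mul_div_assoc, ← mul_div_assoc, ← add_div, div_lt_one (by positivity)] at hk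
  refine ⟨k * N, 2 ^ k, by positivity, ?_, exists_large_growth hA hN k⟩
  have e : ((2 : ℝ) ^ k) ^ 2 = 4 ^ k := by
    rw [← pow_mul, mul_comm, pow_mul]; norm_num
  rw [e]
  push_cast
  simp only [pow_one, pow_zero] at hk
  nlinarith

/-- Square-summable approximate orbits over a cocycle without bounded orbits are controlled by
their errors. -/
theorem tsum_norm_sq_le_of_not_hasBoundedOrbit [CompactSpace Ω] (hc : Continuous A)
    (hA : ∀ ω, ‖(A ω).det‖ = 1) (h : ¬ HasBoundedOrbit T A) :
    ∃ C : ℝ, 0 ≤ C ∧ ∀ (ω : Ω) (y : ℤ → C2) (e : ℤ → ℝ) (Y E : ℝ),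
      (∀ n, ‖y (n + 1) - act (A ((T ^ n) ω)) (y n)‖ ≤ e n) →
      HasSum (fun n => ‖y n‖ ^ 2) Y → HasSum (fun n => e n ^ 2) E → Y ≤ C * E := by
  obtain ⟨K, hK1, hKA, hKI⟩ := exists_norm_act_le_and_le hc hA
  obtain ⟨N, M, hM, hMN, hgrow⟩ := exists_growth_gt_length hc hA h
  set B := 2 * ((N : ℝ) * K ^ N) ^ 2 * (2 * N + 1) with hB
  refine ⟨B, by positivity, fun ω y e Y E hy hY hE => ?_⟩
  have he0 : ∀ n, 0 ≤ e n := fun n => (norm_nonneg _).trans (hy n)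
  have hcard : ((Finset.Icc (-(N : ℤ)) N).card : ℝ) = 2 * N + 1 := by
    rw [Int.card_Icc]
    have : ((N : ℤ) + 1 - -(N : ℤ)).toNat = 2 * N + 1 := by omega
    rw [this]; push_cast; ring
  -- The growth time `n` depends on `p`, so the terms at `p + n` are bounded by sums over the whole
  -- window.
  have hpt : ∀ p, M ^ 2 * ‖y p‖ ^ 2 ≤ 2 * ∑ j ∈ Finset.Icc (-(N : ℤ)) N, ‖y (p + j)‖ ^ 2
      + 2 * ((N : ℝ) * K ^ N) ^ 2 * ∑ j ∈ Finset.Icc (-(N : ℤ)) N, e (p + j) ^ 2 := by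
    intro p
    obtain ⟨n, hn, hg⟩ := hgrow ((T ^ p) ω) (y p)
    have hmem : n ∈ Finset.Icc (-(N : ℤ)) N := Finset.mem_Icc.mpr (abs_le.mp hn)
    set Q := ∑ j ∈ Finset.Icc (-(N : ℤ)) N, e (p + j) ^ 2 with hQ
    have hd := norm_sub_iter_le (E := Real.sqrt Q) hA hK1 hKA hKI hy (fun j hj => by
      refine Real.le_sqrt_of_sq_le ?_
      exact Finset.single_le_sum (f := fun j => e (p + j) ^ 2) (fun i _ => sq_nonneg _)
        (Finset.mem_Icc.mpr (abs_le.mp hj))) hn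
    have hQ0 : 0 ≤ Q := Finset.sum_nonneg fun i _ => sq_nonneg _
    have h1 : M * ‖y p‖ ≤ ‖y (p + n)‖ + N * K ^ N * Real.sqrt Q := by
      refine hg.trans ?_
      have : act (iter T A n ((T ^ p) ω)) (y p)
          = y (p + n) - (y (p + n) - act (iter T A n ((T ^ p) ω)) (y p)) := by abel
      rw [this]
      exact (norm_sub_le _ _).trans (add_le_add le_rfl hd)
    have h2 : ‖y (p + n)‖ ^ 2 ≤ ∑ j ∈ Finset.Icc (-(N : ℤ)) N, ‖y (p + j)‖ ^ 2 :=
      Finset.single_le_sum (f := fun j => ‖y (p + j)‖ ^ 2) (fun i _ => sq_nonneg _) hmem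
    have h3 := pow_le_pow_left₀ (mul_nonneg hM (norm_nonneg _)) h1 2
    have h4 := add_sq_le (a := ‖y (p + n)‖) (b := N * K ^ N * Real.sqrt Q)
    rw [mul_pow _ (Real.sqrt Q), Real.sq_sqrt hQ0] at h4
    rw [mul_pow] at h3
    linarith
  have hsY : HasSum (fun p => ∑ j ∈ Finset.Icc (-(N : ℤ)) N, ‖y (p + j)‖ ^ 2)
      ((2 * N + 1) * Y) := by
    have := hasSum_sum (f := fun (j : ℤ) p => ‖y (p + j)‖ ^ 2) (a := fun _ => Y)
      (s := Finset.Icc (-(N : ℤ)) N) fun j _ => hasSum_add_right hY j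
    rwa [Finset.sum_const, nsmul_eq_mul, hcard] at this
  have hsE : HasSum (fun p => ∑ j ∈ Finset.Icc (-(N : ℤ)) N, e (p + j) ^ 2)
      ((2 * N + 1) * E) := by
    have := hasSum_sum (f := fun (j : ℤ) p => e (p + j) ^ 2) (a := fun _ => E)
      (s := Finset.Icc (-(N : ℤ)) N) fun j _ => hasSum_add_right hE j
    rwa [Finset.sum_const, nsmul_eq_mul, hcard] at this
  -- This reads `M² Y ≤ 2(2N+1) Y + B E`, and `M² ≥ 2(2N+1) + 1` absorbs the first term on the
  -- right.
  have hfin := hasSum_le hpt (hY.mul_left (M ^ 2))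
    ((hsY.mul_left 2).add (hsE.mul_left (2 * ((N : ℝ) * K ^ N) ^ 2)))
  have hY0 : 0 ≤ Y := hY.nonneg fun n => sq_nonneg _
  have hB' : B * E = 2 * ((N : ℝ) * K ^ N) ^ 2 * ((2 * N + 1) * E) := by rw [hB]; ring
  rw [hB']
  nlinarith

end Perturbed

/-! ### Unitary block operators -/

section Theta

variable {a : ℤ → ℂ} {r : ℤ → ℝ}

/-- The direct sum of the unitary blocks `[[conj a_n, r_n], [r_n, -a_n]]` acting on the coordinates
`n, n + 1` with `n + p` even. -/
def theta (a : ℤ → ℂ) (r : ℤ → ℝ) (p : ℤ) (u : ℤ → ℂ) (n : ℤ) : ℂ :=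
  if Even (n + p) then conj (a n) * u n + r n * u (n + 1)
  else r (n - 1) * u (n - 1) - a (n - 1) * u n

/-- The other coordinate in the block of `theta` that contains `n`. -/
def partner (p n : ℤ) : ℤ := if Even (n + p) then n + 1 else n - 1

theorem partner_involutive (p : ℤ) : Function.Involutive (partner p) := by
  intro n
  unfold partner
  by_cases h : Even (n + p)
  · have h' : ¬ Even (n + 1 + p) := by grind
    rw [if_pos h, if_neg h']; ring
  · have h' : Even (n - 1 + p) := by grind
    rw [if_neg h, if_pos h']; ring

/-- Each block is unitary and symmetric, so its inverse is its entrywise conjugate. -/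
theorem theta_conj_theta (hr : ∀ n, (r n : ℂ) ^ 2 = 1 - conj (a n) * a n) (p : ℤ) (u : ℤ → ℂ) :
    theta (fun n => conj (a n)) r p (theta a r p u) = u := by
  funext n
  unfold theta
  by_cases h : Even (n + p)
  · have h' : ¬ Even (n + 1 + p) := by grind
    simp only [if_pos h, if_neg h', add_sub_cancel_right, Complex.conj_conj]
    linear_combination u n * hr n
  · have h' : Even (n - 1 + p) := by grind
    simp only [if_neg h, if_pos h', sub_add_cancel]
    linear_combination u n * hr (n - 1)

theorem norm_sq_block {a x y : ℂ} {r : ℝ} (hr : (r : ℂ) ^ 2 = 1 - conj a * a) :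
    ‖conj a * x + r * y‖ ^ 2 + ‖r * x - a * y‖ ^ 2 = ‖x‖ ^ 2 + ‖y‖ ^ 2 := by
  have : ((‖conj a * x + r * y‖ ^ 2 + ‖r * x - a * y‖ ^ 2 : ℝ) : ℂ)
      = ((‖x‖ ^ 2 + ‖y‖ ^ 2 : ℝ) : ℂ) := by
    push_cast
    simp only [← Complex.conj_mul', map_add, map_sub, map_mul, Complex.conj_conj,
      Complex.conj_ofReal]
    linear_combination (x * conj x + y * conj y) * hr
  exact_mod_cast this

theorem norm_sq_theta_add_partner (hr : ∀ n, (r n : ℂ) ^ 2 = 1 - conj (a n) * a n) (p : ℤ)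
    (u : ℤ → ℂ) (n : ℤ) : ‖theta a r p u n‖ ^ 2 + ‖theta a r p u (partner p n)‖ ^ 2
      = ‖u n‖ ^ 2 + ‖u (partner p n)‖ ^ 2 := by
  unfold theta partner
  by_cases h : Even (n + p)
  · have h' : ¬ Even (n + 1 + p) := by grind
    simp only [if_pos h, if_neg h', add_sub_cancel_right]
    exact norm_sq_block (hr n)
  · have h' : Even (n - 1 + p) := by grind
    simp only [if_neg h, if_pos h', sub_add_cancel]
    rw [add_comm, add_comm (‖u n‖ ^ 2)]
    exact norm_sq_block (hr (n - 1))

theorem hasSum_partner (p : ℤ) {g : ℤ → ℝ} {s : ℝ} (h : HasSum g s) :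
    HasSum (fun n => g (partner p n)) s :=
  (Equiv.hasSum_iff (f := g) (partner_involutive p).toPerm).mpr h

theorem hasSum_norm_sq_theta (hr : ∀ n, (r n : ℂ) ^ 2 = 1 - conj (a n) * a n) (p : ℤ)
    {u : ℤ → ℂ} {s : ℝ} (hu : HasSum (fun n => ‖u n‖ ^ 2) s) :
    HasSum (fun n => ‖theta a r p u n‖ ^ 2) s := by
  have hu' : HasSum (fun n => ‖u (partner p n)‖ ^ 2) s :=
    hasSum_partner p (g := fun n => ‖u n‖ ^ 2) hu
  have hsum : Summable fun n => ‖theta a r p u n‖ ^ 2 :=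
    Summable.of_nonneg_of_le (fun n => sq_nonneg _)
      (fun n => by
        rw [← norm_sq_theta_add_partner hr p u n]
        exact le_add_of_nonneg_right (sq_nonneg _)) (hu.add hu').summable
  obtain ⟨t, ht⟩ := hsum
  have ht' : HasSum (fun n => ‖theta a r p u (partner p n)‖ ^ 2) t :=
    hasSum_partner p (g := fun n => ‖theta a r p u n‖ ^ 2) ht
  -- Pairing each index with its partner counts every block twice on both sides, giving `t + t = s +
  -- s`.
  have h1 := ht.add ht'
  simp only [norm_sq_theta_add_partner hr] at h1
  have h2 := h1.unique (hu.add hu')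
  have : t = s := by linarith
  rwa [this] at ht

theorem hasSum_norm_sq (u : l2Z) : HasSum (fun n => ‖u n‖ ^ 2) (‖u‖ ^ 2) := by
  simpa only [add_zero] using hasSum_sq_shift u 0

/-- The unitary block operator `theta` on `ℓ²(ℤ)`. -/
def thetaL2 (hr : ∀ n, (r n : ℂ) ^ 2 = 1 - conj (a n) * a n) (p : ℤ) (u : l2Z) : l2Z :=
  ⟨theta a r p u, memℓp_gen (by
    simpa only [ENNReal.toReal_ofNat, Real.rpow_ofNat] using
      (hasSum_norm_sq_theta hr p (hasSum_norm_sq u)).summable)⟩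

theorem norm_thetaL2 (hr : ∀ n, (r n : ℂ) ^ 2 = 1 - conj (a n) * a n) (p : ℤ) (u : l2Z) :
    ‖thetaL2 hr p u‖ = ‖u‖ := by
  have h := (hasSum_norm_sq (thetaL2 hr p u)).unique (hasSum_norm_sq_theta hr p (hasSum_norm_sq u))
  exact (sq_eq_sq₀ (norm_nonneg _) (norm_nonneg _)).mp h

theorem thetaL2_surjective (hr : ∀ n, (r n : ℂ) ^ 2 = 1 - conj (a n) * a n) (p : ℤ) :
    Function.Surjective (thetaL2 hr p) := by
  intro w
  have hr' : ∀ n, (r n : ℂ) ^ 2 = 1 - conj (conj (a n)) * conj (a n) := fun n => by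
    rw [hr, Complex.conj_conj, mul_comm]
  refine ⟨thetaL2 hr' p w, ?_⟩
  ext n
  have := theta_conj_theta hr' p w
  simp only [Complex.conj_conj] at this
  exact congrFun this n

end Theta

/-! ### Factorization and unitarity of the extended CMV matrix -/

section Unitary

variable (α : ℤ → 𝔻)

theorem cmvApply_eq_theta (u : ℤ → ℂ) :
    cmvApply α u = theta (fun n => α n) (fun n => rho (α n)) 0
      (theta (fun n => α n) (fun n => rho (α n)) 1 u) := by
  funext n
  unfold cmvApply theta coeffA coeffB coeffC coeffD
  by_cases h : Even n
  · have h1 : ¬ Even (n + 1) := by grind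
    have h2 : Even (n + 1 + 1) := by grind
    simp only [add_zero, if_pos h, if_neg h1, if_pos h2, add_sub_cancel_right]
    rw [show n + 1 + 1 = n + 2 by ring]
    ring
  · have h1 : Even (n + 1) := by grind
    have h2 : ¬ Even (n - 1 + 1) := by grind
    simp only [add_zero, if_neg h, if_pos h1, if_neg h2]
    rw [show n - 1 - 1 = n - 2 by ring]
    ring

theorem cmv_eq_thetaL2 (u : l2Z) :
    cmv α u = thetaL2 (fun n => rho_sq (α n)) 0 (thetaL2 (fun n => rho_sq (α n)) 1 u) := by
  ext n
  exact congrFun (cmvApply_eq_theta α u) n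

theorem cmv_mem_unitary : cmv α ∈ unitary (l2Z →L[ℂ] l2Z) := by
  have hn : ∀ u, ‖cmv α u‖ = ‖u‖ := fun u => by
    rw [cmv_eq_thetaL2, norm_thetaL2, norm_thetaL2]
  have hs : Function.Surjective (cmv α) := by
    rw [show (cmv α : l2Z → l2Z) = _ from funext (cmv_eq_thetaL2 α)]
    exact (thetaL2_surjective _ 0).comp (thetaL2_surjective _ 1)
  let e : l2Z ≃ₗᵢ[ℂ] l2Z := LinearIsometryEquiv.ofSurjective ⟨(cmv α).toLinearMap, hn⟩ hs
  have : cmv α = (Unitary.linearIsometryEquiv.symm e : l2Z →L[ℂ] l2Z) := by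
    ext1 u
    rfl
  rw [this]
  exact (Unitary.linearIsometryEquiv.symm e).2

end Unitary

/-- The bound gives injectivity and closed range; for a normal operator the orthogonal complement of
the range is the kernel, so the range is also dense. -/
theorem isUnit_of_isStarNormal_of_bound {H : Type*} [NormedAddCommGroup H]
    [InnerProductSpace ℂ H] [CompleteSpace H] {S : H →L[ℂ] H} (hS : IsStarNormal S) {C : ℝ}
    (hC : ∀ u, ‖u‖ ≤ C * ‖S u‖) : IsUnit S := by
  have hanti : AntilipschitzWith C.toNNReal S :=
    S.antilipschitz_of_bound fun u => (hC u).trans (by gcongr; exact Real.le_coe_toNNReal C)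
  have hcl : IsClosed (S.range : Set H) := hanti.isClosed_range S.uniformContinuous
  have hker : S.ker = ⊥ := LinearMap.ker_eq_bot.mpr hanti.injective
  have hrange : S.range = ⊤ := by
    rw [← hcl.submodule_topologicalClosure_eq, Submodule.topologicalClosure_eq_top_iff,
      ContinuousLinearMap.IsStarNormal.orthogonal_range hS, hker]
  exact ContinuousLinearMap.isUnit_iff_bijective.mpr
    ⟨hanti.injective, LinearMap.range_eq_top.mp hrange⟩

/-! ### From approximate orbits to the resolvent -/

section Resolvent

variable {Ω : Type*} [TopologicalSpace Ω] [CompactSpace Ω] {T : Ω ≃ₜ Ω} {f : Ω → 𝔻}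

theorem norm_toLp_sq (x y : ℂ) : ‖(!₂[x, y] : C2)‖ ^ 2 = ‖x‖ ^ 2 + ‖y‖ ^ 2 := by
  rw [norm_sq_C2]; rfl

theorem norm_toLp_le (x y : ℂ) : ‖(!₂[x, y] : C2)‖ ≤ ‖x‖ + ‖y‖ := by
  refine (abs_le_of_sq_le_sq' ?_ (by positivity)).2
  rw [norm_toLp_sq]
  nlinarith [norm_nonneg x, norm_nonneg y]

/-- The transfer vector built from `u` and `v = theta 1 u`, normalized so that it evolves by Szegő
matrices. -/
def transferVec (z : ℂ) (u v : ℤ → ℂ) (n : ℤ) : C2 :=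
  z ^ (n / 2) • if Even n then !₂[u n, v n] else !₂[v n, z * u n]

theorem norm_sq_transferVec {z : ℂ} (hz : ‖z‖ = 1) (u v : ℤ → ℂ) (n : ℤ) :
    ‖transferVec z u v n‖ ^ 2 = ‖u n‖ ^ 2 + ‖v n‖ ^ 2 := by
  unfold transferVec
  rw [norm_smul, norm_zpow, hz, one_zpow, one_mul]
  split_ifs
  · exact norm_toLp_sq _ _
  · rw [norm_toLp_sq, norm_mul, hz, one_mul, add_comm]

/-- A step from even `n` uses the `Θ₀` block on `n, n + 1`, where `g` enters. A step from odd `n`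
uses the `Θ₁` block, which holds exactly. -/
theorem norm_transferVec_sub_le (α : ℤ → 𝔻) {z : ℂ} (hz : ‖z‖ = 1) {u v g : ℤ → ℂ}
    (hv : v = theta (fun n => α n) (fun n => rho (α n)) 1 u)
    (hg : ∀ n, theta (fun n => α n) (fun n => rho (α n)) 0 v n = z * u n + g n) (n : ℤ) :
    ‖transferVec z u v (n + 1) - act (szego (α n) z) (transferVec z u v n)‖
      ≤ 2 * (rho (α n))⁻¹ * (‖g n‖ + ‖g (n + 1)‖) := by
  have hz0 : z ≠ 0 := by
    rintro rfl
    simp at hz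
  have hρ := rho_ne_zero (α n)
  have hρ2 := rho_sq (α n)
  have hρi : 1 ≤ (rho (α n))⁻¹ := by
    refine (one_le_inv₀ (rho_pos _)).mpr ?_
    have := norm_rho_le (α n)
    rwa [Complex.norm_real, Real.norm_of_nonneg (rho_nonneg _)] at this
  unfold transferVec
  by_cases h : Even n
  · have h1 : ¬ Even (n + 1) := by grind
    have g0 := hg n
    have g1 := hg (n + 1)
    simp only [theta, add_zero, if_pos h, if_neg h1, add_sub_cancel_right] at g0 g1
    have e : (n + 1) / 2 = n / 2 := by grind
    rw [if_pos h, if_neg h1, e, map_smul, ← smul_sub, norm_smul, norm_zpow, hz, one_zpow, one_mul]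
    have : (!₂[v (n + 1), z * u (n + 1)] : C2) - act (szego (α n) z) !₂[u n, v n]
        = !₂[(rho (α n) : ℂ)⁻¹ * g n, -(rho (α n) : ℂ)⁻¹ * (α n * g n) - g (n + 1)] := by
      rw [act_apply]
      ext i
      fin_cases i
      · simp [szego]
        field_simp
        linear_combination g0
      · simp [szego]
        field_simp
        linear_combination (-(α n : ℂ)) * g0 - (rho (α n) : ℂ) * g1 + v n * hρ2
    rw [this]
    refine (norm_toLp_le _ _).trans ?_
    have b1 : ‖(rho (α n) : ℂ)⁻¹ * g n‖ = (rho (α n))⁻¹ * ‖g n‖ := by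
      rw [norm_mul, norm_inv, Complex.norm_real, Real.norm_of_nonneg (rho_nonneg _)]
    have b2 : ‖-(rho (α n) : ℂ)⁻¹ * (α n * g n) - g (n + 1)‖
        ≤ (rho (α n))⁻¹ * ‖g n‖ + ‖g (n + 1)‖ := by
      refine (norm_sub_le _ _).trans (add_le_add ?_ le_rfl)
      rw [norm_mul, norm_neg, norm_inv, Complex.norm_real, Real.norm_of_nonneg (rho_nonneg _),
        norm_mul]
      have := (α n).norm_lt_one.le
      gcongr
      exact mul_le_of_le_one_left (norm_nonneg _) this
    rw [b1]
    nlinarith [norm_nonneg (g n), norm_nonneg (g (n + 1))]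
  · have h1 : Even (n + 1) := by grind
    have h2 : ¬ Even (n + 1 + 1) := by grind
    have v0 : v n = _ := congrFun hv n
    have v1 : v (n + 1) = _ := congrFun hv (n + 1)
    simp only [theta, if_pos h1, if_neg h2, add_sub_cancel_right] at v0 v1
    -- The odd Szegő step produces an extra factor `z`, absorbed by the jump of the floor `n / 2` in
    -- the prefactor.
    have e : (n + 1) / 2 = n / 2 + 1 := by grind
    have : z ^ ((n + 1) / 2) • (!₂[u (n + 1), v (n + 1)] : C2)
        - act (szego (α n) z) (z ^ (n / 2) • !₂[v n, z * u n]) = 0 := by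
      rw [map_smul, e, zpow_add_one₀ hz0, mul_smul, ← smul_sub, act_apply]
      convert smul_zero _
      rw [v0, v1]
      ext i
      fin_cases i
      · simp [szego]
        field_simp
        ring
      · simp [szego]
        field_simp
        linear_combination z * u n * hρ2
    rw [if_pos h1, if_neg h, this, norm_zero]
    positivity

theorem exists_norm_le_mul_norm_cmv_sub (hf : Continuous f) {z : ℂ} (hz : ‖z‖ = 1)
    (h : ¬ HasBoundedOrbit T (szegoMap f z)) (ω : Ω) :
    ∃ C : ℝ, ∀ u : l2Z, ‖u‖ ≤ C * ‖cmv (verblunsky T f ω) u - z • u‖ := by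
  obtain ⟨C, hC, hbound⟩ := tsum_norm_sq_le_of_not_hasBoundedOrbit (continuous_szegoMap hf z)
    (fun ω => norm_det_szego _ hz) h
  obtain ⟨B, hB⟩ := isCompact_univ.exists_bound_of_continuousOn
    (continuous_rho_inv hf).continuousOn
  have hB' : ∀ ω, (rho (f ω))⁻¹ ≤ B := fun ω => (le_abs_self _).trans (hB ω trivial)
  have hB0 : 0 ≤ B := (inv_nonneg.mpr (rho_nonneg _)).trans (hB' ω)
  -- The squared one-step error is at most `8 B² (‖g n‖² + ‖g (n+1)‖²)`, which sums to `16 B² ‖g‖²`.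
  refine ⟨Real.sqrt (C * (16 * B ^ 2)), fun u => ?_⟩
  set α := verblunsky T f ω with hα
  set g : l2Z := cmv α u - z • u with hgdef
  set v : l2Z := thetaL2 (fun n => rho_sq (α n)) 1 u with hv
  have hg : ∀ n, theta (fun n => α n) (fun n => rho (α n)) 0 v n = z * u n + g n := fun n => by
    have h1 : g n = cmv α u n - z * u n := rfl
    rw [h1, cmv_eq_thetaL2]
    have h2 : thetaL2 (fun n => rho_sq (α n)) 0 v n
      = theta (fun n => α n) (fun n => rho (α n)) 0 v n := rfl
    rw [← hv, h2]
    ring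
  have hrec : ∀ n : ℤ, ‖transferVec z u v (n + 1)
      - act (szegoMap f z ((T ^ n) ω)) (transferVec z u v n)‖
      ≤ Real.sqrt (8 * B ^ 2 * (‖g n‖ ^ 2 + ‖g (n + 1)‖ ^ 2)) := fun n => by
    refine (norm_transferVec_sub_le α hz rfl hg n).trans (Real.le_sqrt_of_sq_le ?_)
    have h3 : (rho (α n))⁻¹ ≤ B := hB' _
    have h4 : 0 ≤ (rho (α n))⁻¹ := inv_nonneg.mpr (rho_nonneg _)
    calc _ ≤ (2 * B * (‖g n‖ + ‖g (n + 1)‖)) ^ 2 := by gcongr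
      _ = 4 * B ^ 2 * (‖g n‖ + ‖g (n + 1)‖) ^ 2 := by ring
      _ ≤ 4 * B ^ 2 * (2 * (‖g n‖ ^ 2 + ‖g (n + 1)‖ ^ 2)) := by
        gcongr
        exact add_sq_le
      _ = _ := by ring
  have hY : HasSum (fun n => ‖transferVec z u v n‖ ^ 2) (‖u‖ ^ 2 + ‖v‖ ^ 2) := by
    simp only [norm_sq_transferVec hz]
    exact (hasSum_norm_sq u).add (hasSum_norm_sq v)
  have hE : HasSum (fun n => Real.sqrt (8 * B ^ 2 * (‖g n‖ ^ 2 + ‖g (n + 1)‖ ^ 2)) ^ 2)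
      (8 * B ^ 2 * (‖g‖ ^ 2 + ‖g‖ ^ 2)) := by
    have h5 : ∀ n : ℤ, 0 ≤ 8 * B ^ 2 * (‖g n‖ ^ 2 + ‖g (n + 1)‖ ^ 2) := fun n => by positivity
    simp only [Real.sq_sqrt (h5 _)]
    exact ((hasSum_norm_sq g).add (hasSum_sq_shift g 1)).mul_left _
  have := hbound ω _ _ _ _ hrec hY hE
  refine (abs_le_of_sq_le_sq' ?_ (by positivity)).2
  rw [mul_pow, Real.sq_sqrt (by positivity)]
  nlinarith [sq_nonneg ‖v‖]

theorem spectrum_cmv_subset (hf : Continuous f) (ω : Ω) :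
    spectrum ℂ (cmv (verblunsky T f ω)) ⊆ Metric.sphere (0 : ℂ) 1 \ hyperbolicSet T f := by
  have hU := cmv_mem_unitary (verblunsky T f ω)
  intro z hz
  refine ⟨spectrum.subset_circle_of_unitary hU hz, ?_⟩
  rintro ⟨hz1, hyp⟩
  have hz1' : ‖z‖ = 1 := by simpa using hz1
  rw [uniformlyHyperbolic_iff (continuous_szegoMap hf z) fun ω => norm_det_szego _ hz1'] at hyp
  obtain ⟨C, hC⟩ := exists_norm_le_mul_norm_cmv_sub hf hz1' hyp ω
  refine (spectrum.mem_iff.mp hz) (isUnit_of_isStarNormal_of_bound (C := C) ?_ fun u => ?_)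
  · have hn : IsStarNormal (cmv (verblunsky T f ω)) :=
      ⟨((Unitary.mem_iff.mp hU).1).trans (Unitary.mem_iff.mp hU).2.symm⟩
    refine ⟨?_⟩
    rw [star_sub, ← algebraMap_star_comm]
    exact ((Algebra.commute_algebraMap_left _ _).sub_right
      (Algebra.commute_algebraMap_left _ _)).sub_left
        ((Algebra.commute_algebraMap_right _ _).sub_right hn.star_comm_self)
  · refine (hC u).trans_eq ?_
    rw [← norm_neg, neg_sub]
    rfl

end Resolvent

end CMV

end

theorem propositionp {Ω : Type*} [MetricSpace Ω] [CompactSpace Ω] (T : Ω ≃ₜ Ω)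
    (f : Ω → Complex.UnitDisc) (hf : Continuous f) :
    (∀ z ∈ Metric.sphere (0 : ℂ) 1,
      (CMV.UniformlyHyperbolic T (CMV.szegoMap f z) ↔
        CMV.UniformlyHyperbolic (T ^ 2) (CMV.iter T (CMV.szegoMap f z) 2)) ∧
      (CMV.UniformlyHyperbolic T (CMV.szegoMap f z) ↔
        CMV.UniformlyHyperbolic (T ^ 2) (CMV.gzMap T f z))) ∧
    ∀ ω : Ω, spectrum ℂ (CMV.cmv (CMV.verblunsky T f ω)) ⊆
      Metric.sphere (0 : ℂ) 1 \ CMV.hyperbolicSet T f :=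
  ⟨fun z hz => CMV.uniformlyHyperbolic_szego_iff hf (by simpa using hz),
    CMV.spectrum_cmv_subset hf⟩
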